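/- For $N\ge 1$ let $U_N$ be a random $N\times N$ unitary matrix distributed according to Haar probability measure on the unitary group $\mathbb{U}_N$, all $U_N$ defined on a common probability space with arbitrary joint law. Let $\mathfrak{Y}_N$ be the set of vectors $\lambda=(\lambda_1,\dots,\lambda_N)$ of nonnegative integers with $\lambda_1\ge\dots\ge\lambda_N$, put $|\lambda|=\lambda_1+\dots+\lambda_N$, and let $s_\lambda(U_N)$ be the Schur polynomial $$s_\lambda(x_1,\dots,x_N)=\frac{\det[x_j^{N-i+\lambda_i}]_{i,j=1}^N}{\det[x_j^{N-i}]_{i,j=1}^N}$$ evaluated at the eigenvalues of $U_N$. Fix $c>0$, put $q_N=1-\frac{c}{N}$, and, for $N>c$, let $$Z_N=\sum_{\lambda\in\mathfrak{Y}_N}q_N^{|\lambda|}\,|s_\lambda(U_N)|^2 .$$ Then, as $N\to\infty$, $$\frac1N\log Z_N\longrightarrow \mu_c=\frac{1-e^{-c}}{c}+\int_1^\infty\frac{e^{-cx}}{x}\,\mathrm{d}x\qquad\text{in probability.}$$ Moreover, for all sufficiently large $N$ the random variable $\log Z_N$ is square-integrable, and $\operatorname{Var}[\log Z_N]=O(N)$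 as $N\to\infty$. -/

import Mathlib

open MeasureTheory ProbabilityTheory Filter Topology

namespace CUESchur

/-! ### Schur polynomials -/

/-- The alternant `det [x_j ^ (N - i + ν_i)]` (rows `i = 1, …, N` are numbered from `0` here). -/
noncomputable def alternant (N : ℕ) (ν : Fin N → ℕ) : MvPolynomial (Fin N) ℂ :=
  Matrix.det (Matrix.of fun i j : Fin N => (MvPolynomial.X j : MvPolynomial (Fin N) ℂ) ^
    (N - 1 - (i : ℕ) + ν i))

/-- The Vandermonde alternant divides every alternant. -/
theorem alternant_zero_dvd (N : ℕ) (ν : Fin N → ℕ) : alternant N 0 ∣ alternant N ν := by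
  classical
  let p : Polynomial (MvPolynomial (Fin N) ℂ) :=
    ∏ j : Fin N, (Polynomial.X - Polynomial.C (MvPolynomial.X j))
  have hp : p.Monic := Polynomial.monic_prod_of_monic _ _ fun j _ => Polynomial.monic_X_sub_C _
  have hdeg : p.natDegree = N := by
    rw [Polynomial.natDegree_prod_of_monic _ _ fun j _ => Polynomial.monic_X_sub_C
      (MvPolynomial.X j : MvPolynomial (Fin N) ℂ)]
    simp
  have hroot : ∀ j : Fin N, p.eval (MvPolynomial.X j) = 0 := by
    intro j
    simp only [p, Polynomial.eval_prod]
    exact Finset.prod_eq_zero (Finset.mem_univ j) (by simp)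
  have key : ∀ (m : ℕ) (j : Fin N), (MvPolynomial.X j : MvPolynomial (Fin N) ℂ) ^ m =
      ∑ k : Fin N, ((Polynomial.X ^ m) %ₘ p).coeff (k : ℕ) * MvPolynomial.X j ^ (k : ℕ) := by
    intro m j
    have h0 : 0 < N := j.pos
    have hne : p ≠ 1 := by
      intro h
      rw [h] at hdeg
      simp at hdeg
      omega
    have hlt : ((Polynomial.X ^ m) %ₘ p).natDegree < N := by
      have := Polynomial.natDegree_modByMonic_lt (Polynomial.X ^ m) hp hne
      omega
    have h1 := congrArg (Polynomial.eval (MvPolynomial.X j : MvPolynomial (Fin N) ℂ))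
      (Polynomial.modByMonic_add_div (Polynomial.X ^ m) p)
    simp only [Polynomial.eval_add, Polynomial.eval_mul, hroot j, zero_mul, add_zero,
      Polynomial.eval_pow, Polynomial.eval_X] at h1
    rw [← h1, Polynomial.eval_eq_sum_range' hlt, Finset.sum_range]
  let c : Matrix (Fin N) (Fin N) (MvPolynomial (Fin N) ℂ) := Matrix.of fun i k =>
    ((Polynomial.X ^ (N - 1 - (i : ℕ) + ν i)) %ₘ p).coeff ((Fin.rev k : Fin N) : ℕ)
  refine ⟨c.det, ?_⟩
  rw [mul_comm, alternant, alternant, ← Matrix.det_mul]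
  congr 1
  ext1 i j
  rw [Matrix.mul_apply]
  simp only [Matrix.of_apply, c, Pi.zero_apply, add_zero]
  rw [key, ← Equiv.sum_comp Fin.revPerm]
  refine Finset.sum_congr rfl fun k _ => ?_
  have : ((Fin.rev k : Fin N) : ℕ) = N - 1 - (k : ℕ) := by
    rw [Fin.val_rev]; omega
  simp only [Fin.revPerm_apply, this]

/-- The Schur polynomial `s_ν(x_1, …, x_N)`: the quotient of alternants in the Weyl character
formula, as a polynomial. -/
noncomputable def schurPoly (N : ℕ) (ν : Fin N → ℕ) : MvPolynomial (Fin N) ℂ :=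
  Classical.choose (alternant_zero_dvd N ν)

theorem alternant_eq (N : ℕ) (ν : Fin N → ℕ) :
    alternant N ν = alternant N 0 * schurPoly N ν :=
  Classical.choose_spec (alternant_zero_dvd N ν)

/-- The denominator is nonzero, so that `alternant_eq` determines `schurPoly`. -/
theorem alternant_zero_ne_zero (N : ℕ) : alternant N 0 ≠ 0 := by
  have h : (Matrix.of fun i j : Fin N => (MvPolynomial.X j : MvPolynomial (Fin N) ℂ) ^
      (N - 1 - (i : ℕ) + (0 : Fin N → ℕ) i)) =
      ((Matrix.vandermonde fun j : Fin N =>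
        (MvPolynomial.X j : MvPolynomial (Fin N) ℂ)).transpose).submatrix Fin.revPerm id := by
    ext1 i j
    have : ((Fin.rev i : Fin N) : ℕ) = N - 1 - (i : ℕ) := by
      rw [Fin.val_rev]; omega
    simp only [Matrix.of_apply, Pi.zero_apply, add_zero, Matrix.submatrix_apply,
      Matrix.transpose_apply, Matrix.vandermonde_apply, Fin.revPerm_apply, id, this]
  rw [alternant, h, Matrix.det_permute, Matrix.det_transpose]
  refine mul_ne_zero ?_ (Matrix.det_vandermonde_ne_zero_iff.2 (MvPolynomial.X_injective))
  rcases Int.units_eq_one_or (Equiv.Perm.sign (Fin.revPerm : Equiv.Perm (Fin N))) with h | h <;>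
    simp [h]

/-! ### Eigenvalues, characters and the partition function -/

theorem exists_eigenvalues {N : ℕ} (V : Matrix (Fin N) (Fin N) ℂ) :
    ∃ u : Fin N → ℂ, Finset.univ.val.map u = V.charpoly.roots := by
  obtain ⟨l, hl⟩ := Quot.exists_rep V.charpoly.roots
  have hcard : l.length = N := by
    have h1 : V.charpoly.roots.card = V.charpoly.natDegree :=
      IsAlgClosed.card_roots_eq_natDegree
    rw [Matrix.charpoly_natDegree_eq_dim, Fintype.card_fin, ← hl] at h1
    exact h1
  subst hcard
  refine ⟨l.get, ?_⟩
  rw [← hl]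
  simp [Fin.univ_val_map]

/-- The eigenvalues `u_1, …, u_N` of a complex matrix, with algebraic multiplicity, in some order. -/
noncomputable def eigenvalues {N : ℕ} (V : Matrix (Fin N) (Fin N) ℂ) : Fin N → ℂ :=
  Classical.choose (exists_eigenvalues V)

theorem map_eigenvalues {N : ℕ} (V : Matrix (Fin N) (Fin N) ℂ) :
    Finset.univ.val.map (eigenvalues V) = V.charpoly.roots :=
  Classical.choose_spec (exists_eigenvalues V)

/-- `s_ν(V)`: the Schur polynomial evaluated at the eigenvalues of `V`. -/
noncomputable def schurChar {N : ℕ} (ν : Fin N → ℕ) (V : Matrix (Fin N) (Fin N) ℂ) : ℂ :=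
  MvPolynomial.eval (eigenvalues V) (schurPoly N ν)

/-- Partitions with at most `N` nonzero parts: weakly decreasing vectors in `ℕ ^ N`. -/
abbrev YoungVec (N : ℕ) : Type := {ν : Fin N → ℕ // Antitone ν}

/-- The partition function `Z_N = ∑_ν q ^ |ν| |s_ν(V)|²` of the Schur measure with fugacity `q`
and environment `V`. -/
noncomputable def partitionFunction {N : ℕ} (q : ℝ) (V : Matrix (Fin N) (Fin N) ℂ) : ℝ :=
  ∑' ν : YoungVec N, q ^ (∑ i, ν.1 i) * ‖schurChar ν.1 V‖ ^ 2

/-- The free energy `log Z_N` at the near-critical fugacity `q_N = 1 - c / N`. -/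
noncomputable def freeEnergy (c : ℝ) {N : ℕ} (V : Matrix (Fin N) (Fin N) ℂ) : ℝ :=
  Real.log (partitionFunction (1 - c / N) V)

/-- The limiting free energy density. -/
noncomputable def mu (c : ℝ) : ℝ :=
  (1 - Real.exp (-c)) / c + ∫ x in Set.Ioi (1 : ℝ), Real.exp (-(c * x)) / x

/-! ### The Circular Unitary Ensemble -/

instance instCompactSpaceUnitaryGroup (N : ℕ) :
    CompactSpace (Matrix.unitaryGroup (Fin N) ℂ) := by
  have hclosed : IsClosed {A : Fin N → Fin N → ℂ |
      (Matrix.of A) ∈ Matrix.unitaryGroup (Fin N) ℂ} := by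
    simp only [Matrix.mem_unitaryGroup_iff]
    have hc : Continuous fun A : Fin N → Fin N → ℂ =>
        (Matrix.of A) * star (Matrix.of A : Matrix (Fin N) (Fin N) ℂ) := by
      have h : Continuous fun A : Fin N → Fin N → ℂ => (Matrix.of A) := continuous_id
      exact h.mul (continuous_star.comp h)
    exact isClosed_eq hc continuous_const
  have hsub : {A : Fin N → Fin N → ℂ | (Matrix.of A) ∈ Matrix.unitaryGroup (Fin N) ℂ} ⊆
      Set.pi Set.univ fun _ => Set.pi Set.univ fun _ => Metric.closedBall (0 : ℂ) 1 := by
    intro A hA i _ j _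
    simpa using entry_norm_bound_of_unitary hA i j
  have hK : IsCompact {A : Fin N → Fin N → ℂ |
      (Matrix.of A) ∈ Matrix.unitaryGroup (Fin N) ℂ} :=
    (isCompact_univ_pi fun _ => isCompact_univ_pi fun _ =>
      isCompact_closedBall (0 : ℂ) 1).of_isClosed_subset hclosed hsub
  exact isCompact_iff_compactSpace.1 hK

noncomputable instance instMeasurableSpaceUnitaryGroup (N : ℕ) :
    MeasurableSpace (Matrix.unitaryGroup (Fin N) ℂ) := borel _

instance instBorelSpaceUnitaryGroup (N : ℕ) :
    BorelSpace (Matrix.unitaryGroup (Fin N) ℂ) := ⟨rfl⟩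

/-- Haar probability measure on the unitary group `U(N)`. -/
noncomputable def haarUnitary (N : ℕ) : Measure (Matrix.unitaryGroup (Fin N) ℂ) :=
  Measure.haarMeasure ⊤

instance instIsProbabilityMeasureHaarUnitary (N : ℕ) : IsProbabilityMeasure (haarUnitary N) :=
  ⟨by simpa [haarUnitary] using
    Measure.haarMeasure_self (K₀ := (⊤ : TopologicalSpace.PositiveCompacts
      (Matrix.unitaryGroup (Fin N) ℂ)))⟩

end CUESchur

namespace CUESchur

/-! ### Laurent polynomials -/

/-! Write `q = 1 - c / N`. The Cauchy identity at the eigenvalues `u_i` of a unitary matrix and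
their conjugates turns the partition function into the product of `(1 - u_i * star u_j * q)⁻¹` over
all pairs. Its logarithm is `∑ q ^ m / m * |Tr U ^ m|²` over `m ≥ 1`
(`hasSum_log_partitionFunction`). The problem becomes one about second and fourth moments of power
traces under Haar measure.

The second moment is `E |Tr U ^ m|² = min m N` (`integral_sqTrace`). Hence the mean of the free
energy, divided by `N`, is `(1 / N) ∑_{m ≤ N} q ^ m` plus the tail `∑_{m > N} q ^ m / m` of the
logarithm series. The first part is geometric and tends to `(1 - e ^ (-c)) / c`. The tail is the
integral of `(1 - s / N) ^ N / s` over `[c, N]`, which converges to the exponential integral by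
dominated convergence. The covariance of `|Tr U ^ m|²` and `|Tr U ^ n|²` is at most `2 min m n`,
plus `m²` when `m = n` (`covariance_sqTrace_le`). Summed against the weights `q ^ m / m` this bounds
the variance by `5 / (1 - q) = 5 N / c`, and Chebyshev's inequality gives convergence in
probability.

The moments hold for all `m`, `n` and `N`, and come from a form of Weyl's integration formula
(`integral_classPairs`): the integral of a polynomial in power traces is the coefficient of `x ^ (0,
1, …, N - 1)` in the corresponding symmetric Laurent polynomial times the Vandermonde determinant.
No integration over the torus is involved. Invariance of Haar measure yields the loop equations
(`integral_loopTerm`), which say that the Casimir operator applied to a product of power traces has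
integral zero. After multiplication by the Vandermonde determinant this operator is diagonal on
monomials. Among alternating Laurent polynomials its eigenspace at the staircase energy is the line
spanned by the Vandermonde determinant, so a polynomial in the operator projects any class function
onto its constant part, and the integral can be read off. -/

/-- Laurent polynomials in `x_1, …, x_N`. -/
abbrev Laurent (N : ℕ) : Type := AddMonoidAlgebra ℂ (Fin N → ℤ)

namespace Laurent

variable {N : ℕ}

/-- The monomial `x_i ^ k`. -/
noncomputable def xpow (i : Fin N) (k : ℤ) : Laurent N := AddMonoidAlgebra.single (Pi.single i k) 1

theorem xpow_add (i : Fin N) (k l : ℤ) : xpow i (k + l) = xpow i k * xpow i l := by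
  simp [xpow, AddMonoidAlgebra.single_mul_single, Pi.single_add]

theorem xpow_zero (i : Fin N) : xpow i 0 = 1 := by
  simp [xpow, AddMonoidAlgebra.one_def]

theorem xpow_natCast (i : Fin N) (k : ℕ) : xpow i (k : ℤ) = xpow i 1 ^ k := by
  induction k with
  | zero => simp [xpow_zero]
  | succ k ih => rw [Nat.cast_succ, xpow_add, ih, pow_succ]

theorem coeff_xpow_mul (i : Fin N) (k : ℤ) (f : Laurent N) (ν : Fin N → ℤ) :
    (xpow i k * f).coeff ν = f.coeff (ν - Pi.single i k) := by
  rw [xpow, AddMonoidAlgebra.coeff_single_mul_apply]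
  simp [sub_eq_neg_add]

/-- The linear map underlying the Euler operator `x_i ∂/∂x_i`. -/
noncomputable def eulerLin (i : Fin N) : Laurent N →ₗ[ℂ] Laurent N where
  toFun f := AddMonoidAlgebra.ofCoeff (Finsupp.onFinset f.coeff.support
    (fun ν => (ν i : ℂ) * f.coeff ν) fun ν h => by
      rw [Finsupp.mem_support_iff]
      exact right_ne_zero_of_mul h)
  map_add' f g := by
    ext ν
    simp [mul_add]
  map_smul' c f := by
    ext ν
    simp [mul_left_comm]

theorem coeff_eulerLin (i : Fin N) (f : Laurent N) (ν : Fin N → ℤ) :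
    (eulerLin i f).coeff ν = ν i * f.coeff ν := by
  simp [eulerLin]

theorem eulerLin_single (i : Fin N) (ν : Fin N → ℤ) (c : ℂ) :
    eulerLin i (AddMonoidAlgebra.single ν c) = AddMonoidAlgebra.single ν ((ν i : ℂ) * c) := by
  ext μ
  rw [coeff_eulerLin]
  by_cases h : ν = μ
  · subst h; simp
  · simp [h]

/-- The Euler operator `x_i ∂/∂x_i`. -/
noncomputable def euler (i : Fin N) : Derivation ℂ (Laurent N) (Laurent N) :=
  Derivation.mk' (eulerLin i) fun f g => by
    induction f using AddMonoidAlgebra.induction_linear with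
    | zero => simp
    | add f₁ f₂ h₁ h₂ => rw [add_mul, map_add, map_add, h₁, h₂]; simp only [smul_eq_mul]; ring
    | single ν c =>
      induction g using AddMonoidAlgebra.induction_linear with
      | zero => simp
      | add f₁ f₂ h₁ h₂ => rw [mul_add, map_add, map_add, h₁, h₂]; simp only [smul_eq_mul]; ring
      | single μ d =>
        simp only [AddMonoidAlgebra.single_mul_single, eulerLin_single, smul_eq_mul]
        rw [add_comm μ ν, ← AddMonoidAlgebra.single_add]
        congr 1
        push_cast [Pi.add_apply]
        ring

theorem coeff_euler (i : Fin N) (f : Laurent N) (ν : Fin N → ℤ) :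
    (euler i f).coeff ν = ν i * f.coeff ν := coeff_eulerLin i f ν

theorem euler_xpow (i j : Fin N) (k : ℤ) :
    euler i (xpow j k) = if i = j then (k : ℂ) • xpow j k else 0 := by
  change eulerLin i _ = _
  rw [xpow, eulerLin_single]
  split_ifs with h
  · subst h; simp [AddMonoidAlgebra.smul_single]
  · simp [h]

/-- The Laurent power sum `∑ x_i ^ k`. -/
noncomputable def psum (N : ℕ) (k : ℤ) : Laurent N := ∑ i, xpow i k

theorem psum_zero : psum N 0 = (N : Laurent N) := by simp [psum, xpow_zero]

theorem euler_psum (i : Fin N) (k : ℤ) : euler i (psum N k) = (k : ℂ) • xpow i k := by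
  simp [psum, euler_xpow]

theorem coeff_psum_mul (k : ℤ) (f : Laurent N) (ν : Fin N → ℤ) :
    (psum N k * f).coeff ν = ∑ i, f.coeff (ν - Pi.single i k) := by
  simp [psum, Finset.sum_mul, coeff_xpow_mul]

/-- The operator `2 x_i ∂/∂x_i - (N - 1)`. -/
noncomputable def shiftedEuler (i : Fin N) (f : Laurent N) : Laurent N :=
  (2 : ℂ) • euler i f - ((N : ℂ) - 1) • f

theorem coeff_shiftedEuler (i : Fin N) (f : Laurent N) (ν : Fin N → ℤ) :
    (shiftedEuler i f).coeff ν = (2 * ν i - (N - 1)) * f.coeff ν := by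
  simp [shiftedEuler, coeff_euler]; ring

/-- The Casimir eigenvalue of a weight, up to normalization. -/
def weightEnergy (ν : Fin N → ℤ) : ℤ := ∑ i, (2 * ν i - (N - 1)) ^ 2

/-- The radial Casimir operator, conjugated by the Vandermonde determinant. -/
noncomputable def radialCasimir (f : Laurent N) : Laurent N :=
  ∑ i, shiftedEuler i (shiftedEuler i f)

theorem coeff_radialCasimir (f : Laurent N) (ν : Fin N → ℤ) :
    (radialCasimir f).coeff ν = weightEnergy ν * f.coeff ν := by
  simp only [radialCasimir, AddMonoidAlgebra.coeff_sum, Finsupp.finsetSum_apply,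
    coeff_shiftedEuler, weightEnergy]
  push_cast
  rw [Finset.sum_mul]
  exact Finset.sum_congr rfl fun i _ => by ring

theorem shiftedEuler_mul (i : Fin N) (f g : Laurent N) :
    shiftedEuler i (f * g) = (2 : ℂ) • (euler i f * g) + f * shiftedEuler i g := by
  simp only [shiftedEuler, Derivation.leibniz, smul_eq_mul, smul_add, mul_sub, mul_smul_comm,
    mul_comm g]
  abel

theorem shiftedEuler_add (i : Fin N) (f g : Laurent N) :
    shiftedEuler i (f + g) = shiftedEuler i f + shiftedEuler i g := by
  simp only [shiftedEuler, map_add, smul_add]; abel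

theorem shiftedEuler_smul (i : Fin N) (c : ℂ) (f : Laurent N) :
    shiftedEuler i (c • f) = c • shiftedEuler i f := by
  simp only [shiftedEuler, Derivation.map_smul, smul_sub, smul_comm c]

/-- Second-order product rule, used with `f` a product of power sums and `g` the Vandermonde
determinant. The shift by `N - 1` stays with `g`, so `f` is hit only by plain Euler operators. -/
theorem radialCasimir_mul (f g : Laurent N) :
    radialCasimir (f * g) = (4 : ℂ) • ((∑ i, euler i (euler i f)) * g +
      ∑ i, euler i f * shiftedEuler i g) + f * radialCasimir g := by
  have h : ∀ i, shiftedEuler i (shiftedEuler i (f * g)) =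
      (4 : ℂ) • (euler i (euler i f) * g + euler i f * shiftedEuler i g) +
        f * shiftedEuler i (shiftedEuler i g) := by
    intro i
    rw [shiftedEuler_mul, shiftedEuler_add, shiftedEuler_smul, shiftedEuler_mul, shiftedEuler_mul]
    module
  simp only [radialCasimir, h, Finset.sum_add_distrib, ← Finset.smul_sum, Finset.sum_mul,
    Finset.mul_sum]

/-! ### The Vandermonde determinant -/

/-- The Vandermonde determinant `det [x_i ^ j]`. -/
noncomputable def vand (N : ℕ) : Laurent N := (Matrix.vandermonde fun i : Fin N => xpow i 1).det

theorem vand_eq_sum : vand N = ∑ σ : Equiv.Perm (Fin N),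
    AddMonoidAlgebra.single (fun i => ((σ i : ℕ) : ℤ)) ((Equiv.Perm.sign σ : ℤ) : ℂ) := by
  rw [vand, ← Matrix.det_transpose, Matrix.det_apply]
  refine Finset.sum_congr rfl fun σ _ => ?_
  have h : ∏ i, (Matrix.vandermonde fun i : Fin N => xpow i 1).transpose (σ i) i =
      AddMonoidAlgebra.single (fun i => ((σ i : ℕ) : ℤ)) (1 : ℂ) := by
    simp only [Matrix.transpose_apply, Matrix.vandermonde_apply, ← xpow_natCast]
    simp only [xpow]
    have : ∀ s : Finset (Fin N), ∏ i ∈ s, (AddMonoidAlgebra.single (Pi.single i ((σ i : ℕ) : ℤ))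
        (1 : ℂ) : Laurent N) =
        AddMonoidAlgebra.single (∑ i ∈ s, Pi.single i ((σ i : ℕ) : ℤ)) 1 := by
      classical
      intro s
      induction s using Finset.induction_on with
      | empty => simp [AddMonoidAlgebra.one_def]
      | insert a s ha ih =>
        rw [Finset.prod_insert ha, Finset.sum_insert ha, ih, AddMonoidAlgebra.single_mul_single,
          one_mul]
    rw [this]
    congr 1
    exact Finset.univ_sum_single (fun i => ((σ i : ℕ) : ℤ))
  rw [h, Units.smul_def, ← Int.cast_smul_eq_zsmul ℂ, AddMonoidAlgebra.smul_single]
  simp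

/-- The weight `(0, 1, …, N - 1)`. -/
def stair (N : ℕ) : Fin N → ℤ := fun i => ((i : ℕ) : ℤ)

theorem stair_injective : Function.Injective (stair N) := fun i j h => by
  simpa [stair, Fin.ext_iff] using h

theorem coeff_vand_perm (σ : Equiv.Perm (Fin N)) :
    (vand N).coeff (stair N ∘ σ) = ((Equiv.Perm.sign σ : ℤ) : ℂ) := by
  simp only [vand_eq_sum, AddMonoidAlgebra.coeff_sum, Finsupp.finsetSum_apply]
  rw [Finset.sum_eq_single σ]
  · rw [AddMonoidAlgebra.coeff_single, Finsupp.single_apply]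
    exact if_pos rfl
  · intro τ _ h
    rw [AddMonoidAlgebra.coeff_single, Finsupp.single_apply, if_neg]
    intro h'
    exact h (Equiv.ext fun i => stair_injective (congrFun h' i))
  · simp

theorem coeff_vand_stair : (vand N).coeff (stair N) = 1 := by
  simpa using coeff_vand_perm (1 : Equiv.Perm (Fin N))

theorem exists_perm_of_coeff_vand_ne_zero {ν : Fin N → ℤ} (h : (vand N).coeff ν ≠ 0) :
    ∃ σ : Equiv.Perm (Fin N), ν = stair N ∘ σ := by
  simp only [vand_eq_sum, AddMonoidAlgebra.coeff_sum, Finsupp.finsetSum_apply] at h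
  obtain ⟨σ, -, hσ⟩ := Finset.exists_ne_zero_of_sum_ne_zero h
  rw [AddMonoidAlgebra.coeff_single, Finsupp.single_apply] at hσ
  exact ⟨σ, by by_contra h'; exact hσ (if_neg fun h'' => h' h''.symm)⟩

theorem vand_ne_zero : vand N ≠ 0 := fun h => by
  have := coeff_vand_stair (N := N)
  simp [h] at this

theorem weightEnergy_comp_perm (ν : Fin N → ℤ) (σ : Equiv.Perm (Fin N)) :
    weightEnergy (ν ∘ σ) = weightEnergy ν :=
  Equiv.sum_comp σ fun i => (2 * ν i - ((N : ℤ) - 1)) ^ 2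

/-- Every monomial of the Vandermonde determinant is a rearrangement of the staircase, and the
energy does not see the order of the entries. -/
theorem radialCasimir_vand : radialCasimir (vand N) = (weightEnergy (stair N) : ℂ) • vand N := by
  ext ν
  rw [coeff_radialCasimir, AddMonoidAlgebra.coeff_smul_apply, smul_eq_mul]
  by_cases h : (vand N).coeff ν = 0
  · simp [h]
  · obtain ⟨σ, rfl⟩ := exists_perm_of_coeff_vand_ne_zero h
    rw [weightEnergy_comp_perm]

/-- Alternating Laurent polynomials. -/
def IsAlternating (f : Laurent N) : Prop :=
  ∀ (σ : Equiv.Perm (Fin N)) (ν : Fin N → ℤ),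
    f.coeff (ν ∘ σ) = ((Equiv.Perm.sign σ : ℤ) : ℂ) * f.coeff ν

theorem isAlternating_vand : IsAlternating (vand N) := by
  intro σ ν
  by_cases h : (vand N).coeff ν = 0
  · rw [h, mul_zero]
    by_contra h'
    obtain ⟨τ, hτ⟩ := exists_perm_of_coeff_vand_ne_zero h'
    have : ν = stair N ∘ (τ * σ⁻¹ : Equiv.Perm (Fin N)) := by
      funext i
      simpa using congrFun hτ (σ⁻¹ i)
    rw [this, coeff_vand_perm] at h
    simp at h
  · obtain ⟨τ, rfl⟩ := exists_perm_of_coeff_vand_ne_zero h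
    have : (stair N ∘ τ) ∘ σ = stair N ∘ (τ * σ : Equiv.Perm (Fin N)) := rfl
    rw [this, coeff_vand_perm, coeff_vand_perm]
    simp [mul_comm]

theorem IsAlternating.psum_mul {f : Laurent N} (hf : IsAlternating f) (k : ℤ) :
    IsAlternating (psum N k * f) := by
  intro σ ν
  simp only [coeff_psum_mul, Finset.mul_sum]
  refine Fintype.sum_equiv σ _ _ fun i => ?_
  rw [← hf σ]
  congr 1
  funext j
  simp [Pi.single_apply]

theorem IsAlternating.coeff_eq_zero {f : Laurent N} (hf : IsAlternating f) {ν : Fin N → ℤ}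
    {i j : Fin N} (hij : i ≠ j) (h : ν i = ν j) : f.coeff ν = 0 := by
  have h1 := hf (Equiv.swap i j) ν
  have h2 : ν ∘ Equiv.swap i j = ν := by
    funext k
    simp only [Function.comp, Equiv.swap_apply_def]
    split_ifs <;> simp_all
  rw [h2, Equiv.Perm.sign_swap hij] at h1
  simp only [Units.val_neg, Units.val_one, Int.cast_neg, Int.cast_one, neg_mul, one_mul] at h1
  linear_combination h1 / 2

end Laurent
end CUESchur

/-! ### Logarithmic derivative of the Vandermonde determinant -/

namespace CUESchur

/-- `sign(k) ∑_{0 ≤ b < |k|} p_{± b} p_{k ∓ b}`, the quadratic part of the loop equation. -/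
def loopSum {A : Type*} [CommRing A] (p : ℤ → A) : ℤ → A
  | (n : ℕ) => ∑ b ∈ Finset.range n, p b * p (n - b)
  | Int.negSucc n => -∑ b ∈ Finset.range (n + 1), p (-b) * p (-(n + 1 - b))

theorem loopSum_natCast {A : Type*} [CommRing A] (p : ℤ → A) (n : ℕ) :
    loopSum p n = ∑ b ∈ Finset.range n, p b * p (n - b) := rfl

theorem loopSum_negSucc {A : Type*} [CommRing A] (p : ℤ → A) (n : ℕ) :
    loopSum p (Int.negSucc n) = -∑ b ∈ Finset.range (n + 1), p (-b) * p (-(n + 1 - b)) := rfl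

theorem derivation_finset_prod {R A ι : Type*} [CommRing R] [CommRing A] [Algebra R A]
    [DecidableEq ι] (D : Derivation R A A) (s : Finset ι) (f : ι → A) :
    D (∏ i ∈ s, f i) = ∑ i ∈ s, D (f i) * ∏ j ∈ s.erase i, f j := by
  induction s using Finset.induction_on with
  | empty => simp
  | insert a s ha ih =>
    rw [Finset.prod_insert ha, Derivation.leibniz, ih, Finset.sum_insert ha,
      Finset.erase_insert ha, smul_eq_mul, smul_eq_mul, Finset.mul_sum, add_comm, mul_comm]
    congr 1
    refine Finset.sum_congr rfl fun i hi => ?_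
    have hia : a ≠ i := fun h => ha (h ▸ hi)
    rw [Finset.erase_insert_of_ne hia, Finset.prod_insert fun h => ha (Finset.mem_of_mem_erase h)]
    ring

theorem sum_sum_eq_two_mul_sum_lt {ι A : Type*} [Fintype ι] [LinearOrder ι] [CommRing A]
    (g : ι → ι → A) (hg : ∀ i j, g i j = g j i) :
    ∑ i, ∑ j, g i j = 2 * ∑ p : ι × ι with p.1 < p.2, g p.1 p.2 + ∑ i, g i i := by
  have h1 : ∑ i, ∑ j, g i j = ∑ p : ι × ι, g p.1 p.2 := (Fintype.sum_prod_type' g).symm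
  have h2 : ∑ p : ι × ι with ¬ p.1 < p.2, g p.1 p.2 =
      ∑ p : ι × ι with p.2 < p.1, g p.1 p.2 + ∑ p : ι × ι with p.1 = p.2, g p.1 p.2 := by
    rw [← Finset.sum_union]
    · congr 1
      ext p
      simp [le_iff_lt_or_eq, eq_comm]
    · rw [Finset.disjoint_filter]
      intro p _ h h'
      exact h.ne' h'
  have h3 : ∑ p : ι × ι with p.2 < p.1, g p.1 p.2 = ∑ p : ι × ι with p.1 < p.2, g p.1 p.2 := by
    simp only [Finset.sum_filter]
    rw [← Equiv.sum_comp (Equiv.prodComm ι ι)]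
    refine Finset.sum_congr rfl fun p _ => ?_
    simp [hg p.2 p.1]
  have h4 : ∑ p : ι × ι with p.1 = p.2, g p.1 p.2 = ∑ i, g i i := by
    rw [Finset.sum_filter, Fintype.sum_prod_type]
    simp
  rw [h1, ← Finset.sum_filter_add_sum_filter_not _ (fun p : ι × ι => p.1 < p.2), h2, h3, h4]
  ring

theorem sum_sum_sum_mul {ι κ A : Type*} [Fintype ι] [CommRing A] (s : Finset κ)
    (f g : ι → κ → A) :
    ∑ i, ∑ j, ∑ b ∈ s, f j b * g i b = ∑ b ∈ s, (∑ j, f j b) * ∑ i, g i b := by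
  simp only [Finset.sum_mul_sum]
  rw [Finset.sum_comm, Finset.sum_congr rfl fun j _ => Finset.sum_comm, Finset.sum_comm]

namespace Laurent

variable {N : ℕ}

theorem vand_eq_prod : vand N =
    ∏ p : Fin N × Fin N with p.1 < p.2, (xpow p.2 1 - xpow p.1 1) := by
  rw [vand, Matrix.det_vandermonde]
  symm
  exact Finset.prod_finset_product' _ Finset.univ (fun i => Finset.Ioi i) (by simp)
    (f := fun i j => (xpow j 1 - xpow i 1 : Laurent N))

/-- `h i j` plays the divided difference of `x ^ (k + 1)` at `x_i`, `x_j`, which is what the Euler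
operators produce from the factor `x_j - x_i`. At `i = j` the condition `hh` is empty: the diagonal
values are arbitrary, because they are added in the double sum and subtracted again. -/
theorem sum_xpow_mul_euler_vand (k : ℤ) (h : Fin N → Fin N → Laurent N)
    (hsymm : ∀ i j, h i j = h j i)
    (hh : ∀ i j, (xpow j 1 - xpow i 1) * h i j = xpow j (k + 1) - xpow i (k + 1)) :
    ∑ i, xpow i k * shiftedEuler i (vand N) =
      (∑ i, ∑ j, h i j - ∑ i, h i i - ((N : Laurent N) - 1) * psum N k) * vand N := by
  classical
  have h1 : ∀ i, euler i (vand N) = ∑ p : Fin N × Fin N with p.1 < p.2,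
      euler i (xpow p.2 1 - xpow p.1 1) *
        ∏ q ∈ ({p : Fin N × Fin N | p.1 < p.2} : Finset _).erase p,
          (xpow q.2 1 - xpow q.1 1) := fun i => by
    rw [vand_eq_prod, derivation_finset_prod]
  have h2 : ∑ i, xpow i k * euler i (vand N) =
      (∑ p : Fin N × Fin N with p.1 < p.2, h p.1 p.2) * vand N := by
    simp only [h1, Finset.mul_sum, Finset.sum_mul]
    rw [Finset.sum_comm]
    refine Finset.sum_congr rfl fun p hp => ?_
    have h3 : ∑ i, xpow i k * euler i (xpow p.2 1 - xpow p.1 1) =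
        xpow p.2 (k + 1) - xpow p.1 (k + 1) := by
      simp [euler_xpow, xpow_add, mul_sub, Finset.sum_sub_distrib]
    simp only [← mul_assoc]
    rw [← Finset.sum_mul, h3, ← hh, vand_eq_prod, ← Finset.mul_prod_erase _ _ hp]
    ring
  have h5 : ∀ i, xpow i k * shiftedEuler i (vand N) =
      2 * (xpow i k * euler i (vand N)) - ((N : Laurent N) - 1) * xpow i k * vand N := by
    intro i
    have e1 : (2 : ℂ) • euler i (vand N) = 2 * euler i (vand N) := by
      rw [two_smul, two_mul]
    have e2 : ((N : ℂ) - 1) • vand N = ((N : Laurent N) - 1) * vand N := by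
      rw [sub_smul, Nat.cast_smul_eq_nsmul, nsmul_eq_mul, one_smul, sub_mul, one_mul]
    rw [shiftedEuler, e1, e2]
    ring
  simp only [h5, Finset.sum_sub_distrib, ← Finset.mul_sum, ← Finset.sum_mul, h2]
  rw [sum_sum_eq_two_mul_sum_lt h hsymm, psum]
  ring

theorem intCast_smul (k : ℤ) (f : Laurent N) : (k : ℂ) • f = (k : Laurent N) * f := by
  rw [Int.cast_smul_eq_zsmul, zsmul_eq_mul]

theorem sum_xpow_natCast_mul_shiftedEuler_vand (n : ℕ) :
    ∑ i, xpow i (n) * shiftedEuler i (vand N) =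
      (loopSum (psum N) (n) - ((n : ℤ) : ℂ) • psum N (n)) * vand N := by
  have hx : ∀ (i : Fin N) (m : ℕ), xpow i (m : ℤ) = xpow i 1 ^ m := fun i m => xpow_natCast i m
  rw [sum_xpow_mul_euler_vand (n : ℤ)
    -- The divided difference as a geometric sum. Its `b = n` term contributes `N p_n`, which
    -- together with the diagonal `(n + 1) p_n` and the shift `(N - 1) p_n` leaves exactly `-n p_n`.
    (fun i j => ∑ b ∈ Finset.range (n + 1), xpow j 1 ^ b * xpow i 1 ^ (n - b))]
  · congr 1
    have e1 : ∑ i : Fin N, ∑ j : Fin N, ∑ b ∈ Finset.range (n + 1),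
        (xpow j 1 ^ b * xpow i 1 ^ (n - b) : Laurent N) =
        ∑ b ∈ Finset.range (n + 1), psum N b * psum N (n - b) := by
      rw [sum_sum_sum_mul]
      refine Finset.sum_congr rfl fun b hb => ?_
      have := Finset.mem_range.1 hb
      rw [← Nat.cast_sub (by omega)]
      simp only [psum, hx]
    have e2 : ∑ i : Fin N, ∑ b ∈ Finset.range (n + 1),
        (xpow i 1 ^ b * xpow i 1 ^ (n - b) : Laurent N) = (n + 1) * psum N n := by
      rw [psum, Finset.mul_sum]
      refine Finset.sum_congr rfl fun i _ => ?_
      rw [Finset.sum_congr rfl (g := fun _ => xpow i (n : ℤ))]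
      · simp
      · intro b hb
        rw [← pow_add, hx]
        congr 1
        have := Finset.mem_range.1 hb
        omega
    rw [e1, e2, intCast_smul, loopSum_natCast, Finset.sum_range_succ, sub_self, psum_zero]
    push_cast
    ring
  · intro i j
    rw [← Finset.sum_range_reflect]
    refine Finset.sum_congr rfl fun b hb => ?_
    have := Finset.mem_range.1 hb
    rw [mul_comm]
    congr 2; omega
  · intro i j
    have := (Commute.all (xpow j (1 : ℤ)) (xpow i 1)).mul_geom_sum₂ (n + 1)
    simp only [Nat.add_sub_cancel] at this
    rw [this, ← hx, ← hx]
    norm_cast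

theorem sum_xpow_negSucc_mul_shiftedEuler_vand (n : ℕ) :
    ∑ i, xpow i (Int.negSucc n) * shiftedEuler i (vand N) =
      (loopSum (psum N) (Int.negSucc n) - ((Int.negSucc n : ℤ) : ℂ) • psum N (Int.negSucc n)) * vand N := by
  have hx : ∀ (i : Fin N) (m : ℕ), xpow i (-(m : ℤ)) = xpow i (-1) ^ m := fun i m => by
    induction m with
    | zero => simp [xpow_zero]
    | succ m ih => rw [pow_succ, ← ih, ← xpow_add]; congr 1; push_cast; ring
  have hinv : ∀ i : Fin N, xpow i 1 * xpow i (-1) = 1 := fun i => by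
    rw [← xpow_add]; simp [xpow_zero]
  rw [sum_xpow_mul_euler_vand (Int.negSucc n)
    -- For negative `k` the divided difference is minus a sum of products of strictly negative
    -- powers. The `b = 0` term of `loopSum`, equal to `-N p_k`, is therefore absent here and comes
    -- from the shift `N - 1` and the diagonal.
    (fun i j => -∑ b ∈ Finset.range n, xpow j (-1) ^ (b + 1) * xpow i (-1) ^ (n - b))]
  · congr 1
    have e1 : ∑ i : Fin N, ∑ j : Fin N, -∑ b ∈ Finset.range n,
        (xpow j (-1) ^ (b + 1) * xpow i (-1) ^ (n - b) : Laurent N) =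
        -∑ b ∈ Finset.range n, psum N (-((b + 1 : ℕ) : ℤ)) * psum N (-(n - b)) := by
      simp only [Finset.sum_neg_distrib]
      rw [sum_sum_sum_mul, neg_inj]
      refine Finset.sum_congr rfl fun b hb => ?_
      have := Finset.mem_range.1 hb
      rw [← Nat.cast_sub (by omega)]
      simp only [psum, hx]
    have e2 : ∑ i : Fin N, -∑ b ∈ Finset.range n,
        (xpow i (-1) ^ (b + 1) * xpow i (-1) ^ (n - b) : Laurent N) =
        -(n * psum N (Int.negSucc n)) := by
      rw [psum, Finset.sum_neg_distrib, Finset.mul_sum, neg_inj]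
      refine Finset.sum_congr rfl fun i _ => ?_
      rw [Finset.sum_congr rfl (g := fun _ => xpow i (Int.negSucc n))]
      · simp
      · intro b hb
        rw [← pow_add, Int.negSucc_eq, ← Nat.cast_succ, hx]
        congr 1
        have := Finset.mem_range.1 hb
        omega
    rw [e1, e2, intCast_smul, loopSum_negSucc, Finset.sum_range_succ']
    simp only [Nat.cast_zero, neg_zero, psum_zero, sub_zero, Nat.cast_add, Nat.cast_one,
      add_sub_add_right_eq_sub, Int.negSucc_eq, Int.cast_neg, Int.cast_add, Int.cast_natCast,
      Int.cast_one]
    ring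
  · intro i j
    rw [← Finset.sum_range_reflect, neg_inj]
    refine Finset.sum_congr rfl fun b hb => ?_
    have := Finset.mem_range.1 hb
    rw [mul_comm]
    congr 2 <;> omega
  · intro i j
    have e : Int.negSucc n + 1 = -(n : ℤ) := by rw [Int.negSucc_eq]; ring
    have h2 : xpow j 1 - xpow i 1 =
        -((xpow j (-1) - xpow i (-1)) * (xpow j 1 * xpow i 1)) := by
      linear_combination xpow i 1 * hinv j - xpow j 1 * hinv i
    have h3 : (xpow j 1 * xpow i 1) * ∑ b ∈ Finset.range n,
        (xpow j (-1) ^ (b + 1) * xpow i (-1) ^ (n - b) : Laurent N) =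
        ∑ b ∈ Finset.range n, xpow j (-1) ^ b * xpow i (-1) ^ (n - 1 - b) := by
      rw [Finset.mul_sum]
      refine Finset.sum_congr rfl fun b hb => ?_
      have : n - b = n - 1 - b + 1 := by
        have := Finset.mem_range.1 hb
        omega
      rw [this, pow_succ, pow_succ]
      linear_combination (xpow j (-1) ^ b * xpow i (-1) ^ (n - 1 - b)) *
        (hinv i + xpow i 1 * xpow i (-1) * hinv j)
    rw [h2, neg_mul_neg, mul_assoc, h3,
      (Commute.all (xpow j (-1 : ℤ)) (xpow i (-1))).mul_geom_sum₂, e, hx, hx]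

theorem sum_xpow_mul_shiftedEuler_vand (k : ℤ) :
    ∑ i, xpow i k * shiftedEuler i (vand N) =
      (loopSum (psum N) k - (k : ℂ) • psum N k) * vand N := by
  rcases k with n | n
  · exact sum_xpow_natCast_mul_shiftedEuler_vand n
  · exact sum_xpow_negSucc_mul_shiftedEuler_vand n

end Laurent
end CUESchur

/-! ### The Casimir operator on power sums, and the weights of minimal energy -/

namespace CUESchur

/-- The left-hand side of the loop equation attached to `p_m ∏_{r ∈ s} p_{k_r}`. -/
noncomputable def loopTerm {A ι : Type*} [CommRing A] [Algebra ℂ A] [DecidableEq ι] (p : ℤ → A)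
    (k : ι → ℤ) (s : Finset ι) (m : ℤ) : A :=
  loopSum p m * ∏ r ∈ s, p (k r) +
    ∑ r ∈ s, (k r : ℂ) • (p (m + k r) * ∏ j ∈ s.erase r, p (k j))

namespace Laurent

variable {N : ℕ} {ι : Type*} [DecidableEq ι]

theorem euler_prod_psum (i : Fin N) (k : ι → ℤ) (s : Finset ι) :
    euler i (∏ r ∈ s, psum N (k r)) =
      ∑ r ∈ s, (k r : ℂ) • (xpow i (k r) * ∏ j ∈ s.erase r, psum N (k j)) := by
  simp only [derivation_finset_prod, euler_psum, smul_mul_assoc]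

theorem sum_xpow_mul_euler_prod_psum (m : ℤ) (k : ι → ℤ) (s : Finset ι) :
    ∑ i, xpow i m * euler i (∏ r ∈ s, psum N (k r)) =
      ∑ r ∈ s, (k r : ℂ) • (psum N (m + k r) * ∏ j ∈ s.erase r, psum N (k j)) := by
  simp only [euler_prod_psum, Finset.mul_sum, mul_smul_comm, ← mul_assoc, ← xpow_add]
  rw [Finset.sum_comm]
  simp only [← Finset.smul_sum, ← Finset.sum_mul, psum]

/-- This matches the Casimir operator with the loop equations. Second derivatives of the product
give the merging terms `p_{k_r + k_l}`, the cross term with the Vandermonde determinant gives the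
splitting terms in `loopSum`, and the two contributions `± k_r p_{k_r}` cancel. -/
theorem radialCasimir_prod_psum_mul_vand (k : ι → ℤ) (s : Finset ι) :
    radialCasimir ((∏ r ∈ s, psum N (k r)) * vand N) =
      (weightEnergy (stair N) : ℂ) • ((∏ r ∈ s, psum N (k r)) * vand N) +
        (4 : ℂ) • ((∑ r ∈ s, (k r : ℂ) • loopTerm (psum N) k (s.erase r) (k r)) * vand N) := by
  have h1 : ∑ i, euler i (euler i (∏ r ∈ s, psum N (k r))) =
      ∑ r ∈ s, (k r : ℂ) • ((k r : ℂ) • psum N (k r) * ∏ j ∈ s.erase r, psum N (k j) +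
        ∑ l ∈ s.erase r, (k l : ℂ) •
          (psum N (k r + k l) * ∏ j ∈ (s.erase r).erase l, psum N (k j))) := by
    simp only [euler_prod_psum _ _ s, map_sum, Derivation.map_smul, Derivation.leibniz,
      smul_eq_mul]
    rw [Finset.sum_comm]
    refine Finset.sum_congr rfl fun r _ => ?_
    rw [← Finset.smul_sum, Finset.sum_add_distrib, sum_xpow_mul_euler_prod_psum, add_comm]
    simp only [euler_xpow, if_true, ← Finset.mul_sum, ← Finset.smul_sum]
    rw [mul_comm, psum]
  have h2 : ∑ i, euler i (∏ r ∈ s, psum N (k r)) * shiftedEuler i (vand N) =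
      ∑ r ∈ s, (k r : ℂ) • (((loopSum (psum N) (k r) - (k r : ℂ) • psum N (k r)) *
        ∏ j ∈ s.erase r, psum N (k j)) * vand N) := by
    simp only [euler_prod_psum, Finset.sum_mul, smul_mul_assoc]
    rw [Finset.sum_comm]
    refine Finset.sum_congr rfl fun r _ => ?_
    rw [← Finset.smul_sum]
    congr 1
    rw [mul_right_comm, ← sum_xpow_mul_shiftedEuler_vand, Finset.sum_mul]
    exact Finset.sum_congr rfl fun i _ => by ring
  rw [radialCasimir_mul, radialCasimir_vand, h1, h2, mul_smul_comm, add_comm]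
  congr 2
  rw [Finset.sum_mul, Finset.sum_mul, ← Finset.sum_add_distrib]
  refine Finset.sum_congr rfl fun r _ => ?_
  simp only [loopTerm, intCast_smul]
  ring

/-- The integers `0, …, N - 1` are the `N` distinct integers closest to `(N - 1) / 2`. Each one
replaced by an integer outside raises its summand from at most `(N - 1)²` to at least `(N + 1)²`, so
equal energy allows no replacement. -/
theorem exists_perm_of_weightEnergy_eq {ν : Fin N → ℤ} (hν : Function.Injective ν)
    (h : weightEnergy ν = weightEnergy (stair N)) :
    ∃ σ : Equiv.Perm (Fin N), ν = stair N ∘ σ := by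
  classical
  set φ : ℤ → ℤ := fun x => (2 * x - (N - 1)) ^ 2 with hφ
  set S : Finset ℤ := Finset.univ.image ν
  set R : Finset ℤ := Finset.univ.image (stair N)
  have hS : ∑ x ∈ S, φ x = weightEnergy ν := Finset.sum_image fun a _ b _ hab => hν hab
  have hR : ∑ x ∈ R, φ x = weightEnergy (stair N) :=
    Finset.sum_image fun a _ b _ hab => stair_injective hab
  have hcard : (S \ R).card = (R \ S).card := by
    apply Finset.card_sdiff_comm
    rw [Finset.card_image_of_injective _ hν, Finset.card_image_of_injective _ stair_injective]
  have hmemR : ∀ x, x ∈ R ↔ 0 ≤ x ∧ x < N := by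
    intro x
    simp only [R, Finset.mem_image, Finset.mem_univ, true_and, stair]
    constructor
    · rintro ⟨a, rfl⟩
      have := a.2
      omega
    · rintro ⟨h1, h2⟩
      exact ⟨⟨x.toNat, by omega⟩, by simp [h1]⟩
  have hsum : ∑ x ∈ S \ R, φ x = ∑ x ∈ R \ S, φ x := by
    have e1 := Finset.sum_inter_add_sum_sdiff S R φ
    have e2 := Finset.sum_inter_add_sum_sdiff R S φ
    rw [Finset.inter_comm] at e2
    linarith
  have h1 : (S \ R).card • (((N : ℤ) + 1) ^ 2) ≤ ∑ x ∈ S \ R, φ x := by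
    refine Finset.card_nsmul_le_sum _ _ _ fun x hx => ?_
    have := (Finset.mem_sdiff.1 hx).2
    rw [hmemR] at this
    simp only [hφ]
    rcases lt_or_ge x 0 with h | h
    · have h' : 2 * x - ((N : ℤ) - 1) ≤ -(N + 1) := by omega
      nlinarith
    · have : (N : ℤ) ≤ x := by
        by_contra h'
        exact this ⟨h, by omega⟩
      nlinarith
  have h2 : ∑ x ∈ R \ S, φ x ≤ (R \ S).card • (((N : ℤ) - 1) ^ 2) := by
    refine Finset.sum_le_card_nsmul _ _ _ fun x hx => ?_
    have := (Finset.mem_sdiff.1 hx).1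
    rw [hmemR] at this
    simp only [hφ]
    nlinarith
  have h3 : (S \ R).card = 0 := by
    rw [hsum] at h1
    have h4 := h1.trans h2
    rw [← hcard, nsmul_eq_mul, nsmul_eq_mul] at h4
    by_contra h5
    have h6 : (0 : ℤ) < (S \ R).card := by positivity
    have h7 := le_of_mul_le_mul_left h4 h6
    have h8 : 0 < (S \ R).card := Nat.pos_of_ne_zero h5
    -- Forces `N ≥ 1`; for `N = 0` the two squares would coincide and give no contradiction.
    have h9 : (S \ R).card ≤ N := by
      calc (S \ R).card ≤ S.card := Finset.card_le_card Finset.sdiff_subset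
        _ ≤ N := by simpa using Finset.card_image_le (s := Finset.univ) (f := ν)
    nlinarith
  have h4 : S ⊆ R := Finset.sdiff_eq_empty_iff_subset.1 (Finset.card_eq_zero.1 h3)
  have h5 : ∀ i, 0 ≤ ν i ∧ ν i < N := fun i =>
    (hmemR _).1 (h4 (Finset.mem_image_of_mem _ (Finset.mem_univ i)))
  let f : Fin N → Fin N := fun i => ⟨(ν i).toNat, by have := h5 i; omega⟩
  have hf : Function.Injective f := fun a b hab => hν (by
    have := congrArg Fin.val hab
    simp only [f] at this
    have := h5 a
    have := h5 b
    omega)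
  refine ⟨Equiv.ofBijective f (Finite.injective_iff_bijective.1 hf), ?_⟩
  funext i
  simp [stair, f, (h5 i).1]

end Laurent
end CUESchur

namespace CUESchur

/-! ### Haar measure and the loop equations -/

instance instIsMulLeftInvariantHaarUnitary (N : ℕ) : (haarUnitary N).IsMulLeftInvariant := by
  unfold haarUnitary; infer_instance

theorem integrable_of_continuous {N : ℕ} {E : Type*} [NormedAddCommGroup E]
    [SecondCountableTopology E] {F : Matrix.unitaryGroup (Fin N) ℂ → E} (hF : Continuous F) :
    Integrable F (haarUnitary N) := by
  borelize E
  obtain ⟨C, hC⟩ := (isCompact_range hF).isBounded.exists_norm_le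
  exact Integrable.of_bound hF.aestronglyMeasurable C
    (Eventually.of_forall fun U => hC _ (Set.mem_range_self U))

theorem exp_add_smul {N : ℕ} (X : Matrix (Fin N) (Fin N) ℂ) (s t : ℝ) :
    NormedSpace.exp ((s + t) • X) = NormedSpace.exp (s • X) * NormedSpace.exp (t • X) := by
  rw [add_smul]
  exact Matrix.exp_add_of_commute _ _ (((Commute.refl X).smul_left s).smul_right t)

theorem exp_smul_mem_unitaryGroup {N : ℕ} {X : Matrix (Fin N) (Fin N) ℂ} (hX : star X = -X)
    (t : ℝ) : NormedSpace.exp (t • X) ∈ Matrix.unitaryGroup (Fin N) ℂ := by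
  have h : star (NormedSpace.exp (t • X)) = NormedSpace.exp ((-t) • X) := by
    rw [Matrix.star_eq_conjTranspose, ← Matrix.exp_conjTranspose, Matrix.conjTranspose_smul,
      ← Matrix.star_eq_conjTranspose, hX, star_trivial, smul_neg, neg_smul]
  rw [Matrix.mem_unitaryGroup_iff, h, ← exp_add_smul, add_neg_cancel, zero_smul,
    NormedSpace.exp_zero]

theorem hasDerivAt_exp_smul_apply {N : ℕ} (X : Matrix (Fin N) (Fin N) ℂ) (i j : Fin N) :
    HasDerivAt (fun t : ℝ => NormedSpace.exp (t • X) i j) (X i j) 0 := by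
  -- Any Banach algebra norm on matrices serves to differentiate the exponential; the entrywise
  -- statement does not depend on it.
  let _ : NormedRing (Matrix (Fin N) (Fin N) ℂ) := Matrix.linftyOpNormedRing
  let _ : NormedAlgebra ℝ (Matrix (Fin N) (Fin N) ℂ) := Matrix.linftyOpNormedAlgebra
  have h := hasDerivAt_exp_smul_const (𝕂 := ℝ) X (0 : ℝ)
  rw [zero_smul, NormedSpace.exp_zero, one_mul] at h
  let L : Matrix (Fin N) (Fin N) ℂ →L[ℝ] ℂ :=
    LinearMap.toContinuousLinearMap ((Matrix.entryLinearMap ℝ ℂ i j))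
  exact L.hasFDerivAt.comp_hasDerivAt (0 : ℝ) h

variable {N : ℕ}

/-- The one-parameter subgroup generated by a skew-Hermitian matrix. -/
noncomputable def expUnitary (X : Matrix (Fin N) (Fin N) ℂ) (hX : star X = -X) (t : ℝ) :
    Matrix.unitaryGroup (Fin N) ℂ :=
  ⟨NormedSpace.exp (t • X), exp_smul_mem_unitaryGroup hX t⟩

theorem expUnitary_add (X : Matrix (Fin N) (Fin N) ℂ) (hX : star X = -X) (s t : ℝ) :
    expUnitary X hX (s + t) = expUnitary X hX s * expUnitary X hX t :=
  Subtype.ext (exp_add_smul X s t)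

theorem expUnitary_zero (X : Matrix (Fin N) (Fin N) ℂ) (hX : star X = -X) :
    expUnitary X hX 0 = 1 :=
  Subtype.ext (by simp [expUnitary])

/-- By left invariance the integral of `F (exp (t X) U)` does not depend on `t`; differentiate under
the integral sign, with a constant bound from compactness. -/
theorem integral_lieDeriv_eq_zero (X : Matrix (Fin N) (Fin N) ℂ) (hX : star X = -X)
    {F F' : Matrix.unitaryGroup (Fin N) ℂ → ℂ} (hF : Continuous F) (hF' : Continuous F')
    (h : ∀ U, HasDerivAt (fun t : ℝ => F (expUnitary X hX t * U)) (F' U) 0) :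
    ∫ U, F' U ∂(haarUnitary N) = 0 := by
  obtain ⟨C, hC⟩ := (isCompact_range hF').isBounded.exists_norm_le
  -- The one-parameter group law carries the derivative at `0` to every `t`.
  have hderiv : ∀ U (t : ℝ), HasDerivAt (fun t : ℝ => F (expUnitary X hX t * U))
      (F' (expUnitary X hX t * U)) t := by
    intro U t
    have h1 := h (expUnitary X hX t * U)
    rw [← sub_self t] at h1
    have h2 := h1.comp_sub_const t t
    refine h2.congr_of_eventuallyEq (Eventually.of_forall fun s => ?_)
    simp only
    rw [← mul_assoc, ← expUnitary_add, sub_add_cancel]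
  have key := (hasDerivAt_integral_of_dominated_loc_of_deriv_le (μ := haarUnitary N)
    (F := fun (t : ℝ) U => F (expUnitary X hX t * U))
    (F' := fun (t : ℝ) U => F' (expUnitary X hX t * U)) (x₀ := 0) (s := Set.univ)
    (bound := fun _ => C) univ_mem
    (Eventually.of_forall fun t =>
      (hF.comp (continuous_const_mul (expUnitary X hX t))).aestronglyMeasurable)
    (integrable_of_continuous (hF.comp (continuous_const_mul _)))
    (hF'.comp (continuous_const_mul _)).aestronglyMeasurable
    (Eventually.of_forall fun U t _ => hC _ (Set.mem_range_self _))
    (integrable_const C)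
    (Eventually.of_forall fun U t _ => hderiv U t)).2
  have hconst : (fun t : ℝ => ∫ U, F (expUnitary X hX t * U) ∂(haarUnitary N)) =
      fun _ => ∫ U, F U ∂(haarUnitary N) := by
    funext t
    exact integral_mul_left_eq_self F _
  rw [hconst] at key
  have := key.unique (hasDerivAt_const 0 _)
  simpa [expUnitary_zero] using this

/-- The trace of an integer power of a unitary matrix. -/
noncomputable def powTrace (k : ℤ) (U : Matrix.unitaryGroup (Fin N) ℂ) : ℂ :=
  ((U ^ k : Matrix.unitaryGroup (Fin N) ℂ) : Matrix (Fin N) (Fin N) ℂ).trace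

theorem continuous_zpow_coe (k : ℤ) : Continuous fun U : Matrix.unitaryGroup (Fin N) ℂ =>
    ((U ^ k : Matrix.unitaryGroup (Fin N) ℂ) : Matrix (Fin N) (Fin N) ℂ) :=
  continuous_subtype_val.comp (continuous_zpow k)

theorem continuous_powTrace (k : ℤ) :
    Continuous (powTrace k : Matrix.unitaryGroup (Fin N) ℂ → ℂ) :=
  (continuous_zpow_coe k).matrix_trace

theorem powTrace_neg (k : ℤ) (U : Matrix.unitaryGroup (Fin N) ℂ) :
    powTrace (-k) U = star (powTrace k U) := by
  rw [powTrace, powTrace, ← Matrix.trace_conjTranspose, zpow_neg]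
  rfl

theorem hasDerivAt_matrix_mul_apply {A B : ℝ → Matrix (Fin N) (Fin N) ℂ}
    {A' B' : Matrix (Fin N) (Fin N) ℂ} {t : ℝ}
    (hA : ∀ i j, HasDerivAt (fun t => A t i j) (A' i j) t)
    (hB : ∀ i j, HasDerivAt (fun t => B t i j) (B' i j) t) (i j : Fin N) :
    HasDerivAt (fun t => (A t * B t) i j) ((A' * B t + A t * B') i j) t := by
  simp only [Matrix.mul_apply, Matrix.add_apply, ← Finset.sum_add_distrib]
  exact HasDerivAt.fun_sum fun l _ => (hA i l).mul (hB l j)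

theorem hasDerivAt_expUnitary_mul_pow (X : Matrix (Fin N) (Fin N) ℂ) (hX : star X = -X)
    (U : Matrix.unitaryGroup (Fin N) ℂ) (k : ℕ) (i j : Fin N) :
    HasDerivAt (fun t : ℝ => (((expUnitary X hX t * U : Matrix.unitaryGroup (Fin N) ℂ) :
        Matrix (Fin N) (Fin N) ℂ) ^ k) i j)
      ((∑ b ∈ Finset.range k, U.1 ^ b * X * U.1 ^ (k - b)) i j) 0 := by
  have hbase : ∀ i j, HasDerivAt (fun t : ℝ => ((expUnitary X hX t * U :
      Matrix.unitaryGroup (Fin N) ℂ) : Matrix (Fin N) (Fin N) ℂ) i j) ((X * U.1) i j) 0 := by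
    intro i j
    have := hasDerivAt_matrix_mul_apply (A := fun t : ℝ => NormedSpace.exp (t • X))
      (B := fun _ => U.1) (A' := X) (B' := 0) (t := 0)
      (hasDerivAt_exp_smul_apply X) (fun i j => hasDerivAt_const _ _) i j
    rw [zero_smul, NormedSpace.exp_zero, mul_zero, add_zero] at this
    exact this
  induction k generalizing i j with
  | zero => simpa using hasDerivAt_const _ _
  | succ k ih =>
    have := hasDerivAt_matrix_mul_apply ih hbase i j
    simp only [pow_succ]
    convert this using 1
    refine congrArg (fun M : Matrix (Fin N) (Fin N) ℂ => M i j) ?_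
    rw [Finset.sum_range_succ, Finset.sum_mul, expUnitary_zero, one_mul, Nat.add_sub_cancel_left,
      pow_one, mul_assoc (U.1 ^ k)]
    refine congrArg (· + _) (Finset.sum_congr rfl fun b hb => ?_)
    rw [mul_assoc _ (U.1 ^ (k - b)), ← pow_succ, Nat.sub_add_comm (Finset.mem_range.1 hb).le]

theorem hasDerivAt_powTrace_natCast (X : Matrix (Fin N) (Fin N) ℂ) (hX : star X = -X)
    (U : Matrix.unitaryGroup (Fin N) ℂ) (k : ℕ) :
    HasDerivAt (fun t : ℝ => powTrace k (expUnitary X hX t * U))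
      (k * (X * ((U ^ (k : ℤ) : Matrix.unitaryGroup (Fin N) ℂ) : Matrix _ _ ℂ)).trace) 0 := by
  have h : HasDerivAt (fun t : ℝ => powTrace k (expUnitary X hX t * U))
      (∑ b ∈ Finset.range k, U.1 ^ b * X * U.1 ^ (k - b)).trace 0 := by
    simp only [powTrace, Matrix.trace, Matrix.diag, zpow_natCast, SubmonoidClass.coe_pow]
    exact HasDerivAt.fun_sum fun i _ => hasDerivAt_expUnitary_mul_pow X hX U k i i
  convert h using 1
  rw [Matrix.trace_sum, Finset.sum_congr rfl (g := fun _ => (X * U.1 ^ k).trace)]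
  · simp
  · intro b hb
    rw [mul_assoc, Matrix.trace_mul_comm, mul_assoc, ← pow_add,
      Nat.sub_add_cancel (Finset.mem_range.1 hb).le]

theorem hasDerivAt_powTrace (X : Matrix (Fin N) (Fin N) ℂ) (hX : star X = -X)
    (U : Matrix.unitaryGroup (Fin N) ℂ) (k : ℤ) :
    HasDerivAt (fun t : ℝ => powTrace k (expUnitary X hX t * U))
      (k * (X * ((U ^ k : Matrix.unitaryGroup (Fin N) ℂ) : Matrix _ _ ℂ)).trace) 0 := by
  obtain ⟨n, rfl | rfl⟩ := k.eq_nat_or_neg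
  · exact_mod_cast hasDerivAt_powTrace_natCast X hX U n
  · have h := (hasDerivAt_powTrace_natCast X hX U n).star
    simp only [powTrace_neg]
    refine h.congr_deriv ?_
    rw [star_mul', ← Matrix.trace_conjTranspose, Matrix.conjTranspose_mul,
      ← Matrix.star_eq_conjTranspose X, hX, Matrix.mul_neg, Matrix.trace_neg,
      Matrix.trace_mul_comm X, zpow_neg]
    simp [Matrix.star_eq_conjTranspose]

variable {ι : Type*} [DecidableEq ι]

/-- The derivative of `(U ^ m)_{ij} ∏_{r ∈ s} Tr U ^ {k_r}` in the direction `X`. -/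
noncomputable def loopDeriv (m : ℕ) (k : ι → ℤ) (s : Finset ι) (i j : Fin N)
    (X : Matrix (Fin N) (Fin N) ℂ) (U : Matrix.unitaryGroup (Fin N) ℂ) : ℂ :=
  (∑ b ∈ Finset.range m, U.1 ^ b * X * U.1 ^ (m - b)) i j * ∏ r ∈ s, powTrace (k r) U +
    (U.1 ^ m) i j * ∑ r ∈ s, (∏ l ∈ s.erase r, powTrace (k l) U) •
      ((k r : ℂ) * (X * ((U ^ k r : Matrix.unitaryGroup (Fin N) ℂ) : Matrix _ _ ℂ)).trace)

theorem continuous_loopDeriv (m : ℕ) (k : ι → ℤ) (s : Finset ι) (i j : Fin N)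
    (X : Matrix (Fin N) (Fin N) ℂ) : Continuous (loopDeriv m k s i j X) := by
  have h1 := fun k => continuous_powTrace (N := N) k
  have h2 := fun k => continuous_zpow_coe (N := N) k
  have h3 : ∀ A : Matrix.unitaryGroup (Fin N) ℂ → Matrix (Fin N) (Fin N) ℂ,
      Continuous A → Continuous fun U => A U i j := fun A hA =>
    hA.matrix_elem i j
  have h4 : Continuous fun U : Matrix.unitaryGroup (Fin N) ℂ => U.1 := continuous_subtype_val
  unfold loopDeriv
  refine ((h3 _ ?_).mul ?_).add ((h3 _ ?_).mul ?_)
  · exact continuous_finsetSum _ fun b _ => ((h4.pow b).mul continuous_const).mul (h4.pow _)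
  · exact continuous_finsetProd _ fun r _ => h1 _
  · exact h4.pow m
  · exact continuous_finsetSum _ fun r _ => (continuous_finsetProd _ fun r _ => h1 _).smul
      (continuous_const.mul (continuous_const.mul (h2 _)).matrix_trace)

theorem integral_loopDeriv_of_skew (m : ℕ) (k : ι → ℤ) (s : Finset ι) (i j : Fin N)
    (X : Matrix (Fin N) (Fin N) ℂ) (hX : star X = -X) :
    ∫ U, loopDeriv m k s i j X U ∂(haarUnitary N) = 0 := by
  refine integral_lieDeriv_eq_zero X hX
    (F := fun U => (U.1 ^ m) i j * ∏ r ∈ s, powTrace (k r) U) ?_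
    (continuous_loopDeriv m k s i j X) fun U => ?_
  · exact ((continuous_subtype_val.pow m).matrix_elem i j).mul
      (continuous_finsetProd _ fun r _ => continuous_powTrace _)
  · have := (hasDerivAt_expUnitary_mul_pow X hX U m i j).mul
      (HasDerivAt.fun_finsetProd fun r (_ : r ∈ s) => hasDerivAt_powTrace X hX U (k r))
    rw [expUnitary_zero, one_mul] at this
    exact this

/-- The derivative formula is complex linear in the direction, and every complex matrix is `A + i B`
with `A`, `B` skew-Hermitian. This admits matrix units as directions, although they do not generate
unitary subgroups. -/
theorem integral_loopDeriv (m : ℕ) (k : ι → ℤ) (s : Finset ι) (i j : Fin N)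
    (X : Matrix (Fin N) (Fin N) ℂ) :
    ∫ U, loopDeriv m k s i j X U ∂(haarUnitary N) = 0 := by
  set A : Matrix (Fin N) (Fin N) ℂ := (1 / 2 : ℂ) • (X - star X) with hA
  set B : Matrix (Fin N) (Fin N) ℂ := (-Complex.I / 2 : ℂ) • (X + star X) with hB
  have hAs : star A = -A := by
    rw [hA, star_smul, star_sub, star_star, ← smul_neg, neg_sub]
    simp
  have hBs : star B = -B := by
    rw [hB, star_smul, star_add, star_star, ← neg_smul, add_comm]
    congr 1
    simp [neg_div]
  have hX : X = A + Complex.I • B := by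
    rw [hA, hB, smul_smul, show Complex.I * (-Complex.I / 2) = 1 / 2 by
      linear_combination (-1 / 2) * Complex.I_mul_I, ← smul_add]
    rw [sub_add_add_cancel, ← two_smul ℂ X, smul_smul]
    norm_num
  have h : ∀ U, loopDeriv m k s i j X U =
      loopDeriv m k s i j A U + Complex.I * loopDeriv m k s i j B U := by
    intro U
    conv_lhs => rw [hX]
    simp only [loopDeriv, mul_add, add_mul, Finset.sum_add_distrib, Matrix.add_apply,
      Matrix.trace_add, mul_smul_comm, smul_mul_assoc, ← Finset.smul_sum,
      Matrix.smul_apply, Matrix.trace_smul, smul_eq_mul]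
    simp only [Finset.mul_sum, mul_left_comm _ Complex.I]
    ring
  simp only [h]
  rw [integral_add (integrable_of_continuous (continuous_loopDeriv m k s i j A))
    ((integrable_of_continuous (continuous_loopDeriv m k s i j B)).const_mul _),
    integral_const_mul, integral_loopDeriv_of_skew _ _ _ _ _ _ hAs,
    integral_loopDeriv_of_skew _ _ _ _ _ _ hBs]
  simp

/-- Summation over matrix units splits one trace into two, `∑ (U ^ b E_ij U ^ c)_ij = Tr U ^ b Tr U
^ c`, and merges two into one, `∑ (U ^ m)_ij Tr (E_ij U ^ l) = Tr U ^ (m + l)`. -/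
theorem sum_loopDeriv_single (m : ℕ) (k : ι → ℤ) (s : Finset ι)
    (U : Matrix.unitaryGroup (Fin N) ℂ) :
    ∑ i, ∑ j, loopDeriv m k s i j (Matrix.single i j 1) U =
      loopTerm (fun l => powTrace l U) k s m := by
  have h1 : ∀ (b c : ℕ) (i j : Fin N),
      ((U.1 ^ b * Matrix.single i j 1 * U.1 ^ c : Matrix (Fin N) (Fin N) ℂ)) i j =
      (U.1 ^ b) i i * (U.1 ^ c) j j := by
    intro b c i j
    rw [mul_assoc, Matrix.mul_apply, Finset.sum_eq_single i]
    · simp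
    · intro l _ hl
      simp [Matrix.single_mul_apply_of_ne _ _ _ _ _ hl]
    · simp
  have h2 : ∀ (l : ℤ) (i j : Fin N), (Matrix.single i j (1 : ℂ) *
      ((U ^ l : Matrix.unitaryGroup (Fin N) ℂ) : Matrix _ _ ℂ)).trace =
      ((U ^ l : Matrix.unitaryGroup (Fin N) ℂ) : Matrix _ _ ℂ) j i := by
    intro l i j
    simp [Matrix.trace_single_mul]
  have h3 : ∀ l : ℤ, ∑ i, ∑ j, (U.1 ^ m) i j *
      ((U ^ l : Matrix.unitaryGroup (Fin N) ℂ) : Matrix _ _ ℂ) j i = powTrace (m + l) U := by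
    intro l
    rw [powTrace, zpow_add, zpow_natCast, Matrix.UnitaryGroup.mul_val, SubmonoidClass.coe_pow,
      Matrix.trace]
    simp [Matrix.mul_apply]
  have h4 : ∀ b : ℕ, ∑ i, (U.1 ^ b) i i = powTrace b U := by
    intro b
    simp [powTrace, Matrix.trace]
  have h5 : ∑ i, ∑ j, (∑ b ∈ Finset.range m,
      U.1 ^ b * Matrix.single i j 1 * U.1 ^ (m - b) : Matrix (Fin N) (Fin N) ℂ) i j =
      loopSum (fun l => powTrace l U) m := by
    simp only [Matrix.sum_apply, h1]
    rw [Finset.sum_comm, sum_sum_sum_mul (Finset.range m) (fun i b => (U.1 ^ b) i i)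
      (fun j b => (U.1 ^ (m - b)) j j), loopSum_natCast]
    refine Finset.sum_congr rfl fun b hb => ?_
    rw [h4, h4, Nat.cast_sub (Finset.mem_range.1 hb).le]
  unfold loopTerm
  simp only [loopDeriv, h2, Finset.sum_add_distrib, ← Finset.sum_mul, h5]
  congr 1
  simp only [Finset.mul_sum]
  rw [Finset.sum_congr rfl fun i _ => Finset.sum_comm, Finset.sum_comm]
  refine Finset.sum_congr rfl fun r _ => ?_
  rw [← h3, Finset.sum_mul, Finset.smul_sum]
  refine Finset.sum_congr rfl fun i _ => ?_
  rw [Finset.sum_mul, Finset.smul_sum]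
  refine Finset.sum_congr rfl fun j _ => ?_
  simp only [smul_eq_mul]
  ring

theorem integral_loopTerm_natCast (m : ℕ) (k : ι → ℤ) (s : Finset ι) :
    ∫ U, loopTerm (fun l => powTrace l U) k s m ∂(haarUnitary N) = 0 := by
  simp only [← sum_loopDeriv_single]
  have h := fun i j : Fin N => integrable_of_continuous
    (continuous_loopDeriv m k s i j (Matrix.single i j (1 : ℂ)))
  rw [integral_finsetSum _ fun i _ => integrable_finsetSum _ fun j _ => h i j]
  refine Finset.sum_eq_zero fun i _ => ?_
  rw [integral_finsetSum _ fun j _ => h i j]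
  exact Finset.sum_eq_zero fun j _ => integral_loopDeriv _ _ _ _ _ _

/-- Conjugation negates all exponents of power traces, so the loop equations for negative `m` follow
from those for natural `m`. -/
theorem loopTerm_neg (m : ℕ) (k : ι → ℤ) (s : Finset ι) (U : Matrix.unitaryGroup (Fin N) ℂ) :
    loopTerm (fun l => powTrace l U) k s (-m) =
      -star (loopTerm (fun l => powTrace l U) (fun r => -k r) s m) := by
  have h : loopSum (fun l => powTrace l U) (-m) = -star (loopSum (fun l => powTrace l U) m) := by
    cases m with
    | zero => simp [show loopSum (fun l => powTrace l U) 0 = 0 from rfl]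
    | succ n =>
      rw [show (-((n + 1 : ℕ) : ℤ)) = Int.negSucc n from rfl, loopSum_negSucc, loopSum_natCast,
        star_sum]
      simp only [star_mul', powTrace_neg, Nat.cast_succ]
  simp only [loopTerm, h, star_add, star_mul', star_prod, star_sum, star_smul, ← powTrace_neg,
    neg_neg, neg_add, neg_mul, ← Finset.sum_neg_distrib]
  simp

theorem integral_loopTerm (m : ℤ) (k : ι → ℤ) (s : Finset ι) :
    ∫ U, loopTerm (fun l => powTrace l U) k s m ∂(haarUnitary N) = 0 := by
  obtain ⟨n, rfl | rfl⟩ := m.eq_nat_or_neg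
  · exact integral_loopTerm_natCast n k s
  · simp only [loopTerm_neg]
    rw [integral_neg]
    have := integral_conj (𝕜 := ℂ) (μ := haarUnitary N)
      (f := fun U => loopTerm (fun l => powTrace l U) (fun r => -k r) s n)
    rw [integral_loopTerm_natCast] at this
    simpa using this

end CUESchur

namespace CUESchur

/-! ### Eigenvalues and power sums -/

variable {N : ℕ}

theorem charpoly_eq_prod_eigenvalues (V : Matrix (Fin N) (Fin N) ℂ) :
    V.charpoly = ∏ i, (Polynomial.X - Polynomial.C (eigenvalues V i)) := by
  have h := (IsAlgClosed.splits V.charpoly).eq_prod_roots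
  rw [V.charpoly_monic.leadingCoeff, Polynomial.C_1, one_mul, ← map_eigenvalues,
    Multiset.map_map] at h
  exact h

/-- Over `ℂ` the polynomial splits, and each linear factor is, up to sign, a value of the
characteristic polynomial of `V`. Taking `p = x - X ^ k` later gives the characteristic polynomial
of `V ^ k`, hence its trace, without triangularization. -/
theorem det_aeval_eq_prod (V : Matrix (Fin N) (Fin N) ℂ) (p : Polynomial ℂ) :
    (Polynomial.aeval V p).det = ∏ i, p.eval (eigenvalues V i) := by
  have h1 : ∀ a : ℂ, (Polynomial.aeval V (Polynomial.X - Polynomial.C a)).det =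
      ∏ i, (eigenvalues V i - a) := by
    intro a
    have h2 : Polynomial.aeval V (Polynomial.X - Polynomial.C a) = -(Matrix.scalar _ a - V) := by
      simp [Matrix.algebraMap_eq_diagonal, Matrix.scalar_apply]
    rw [h2, Matrix.det_neg, ← Matrix.eval_charpoly, charpoly_eq_prod_eigenvalues,
      Polynomial.eval_prod, ← Finset.card_univ, ← Finset.prod_const, ← Finset.prod_mul_distrib]
    exact Finset.prod_congr rfl fun i _ => by simp
  have h := (IsAlgClosed.splits p).eq_prod_roots
  generalize p.roots = s at h
  generalize p.leadingCoeff = c at h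
  subst h
  induction s using Multiset.induction_on with
  | empty => simp [Matrix.algebraMap_eq_diagonal, Matrix.det_diagonal]
  | cons a s ih =>
    rw [Multiset.map_cons, Multiset.prod_cons, mul_left_comm, map_mul, Matrix.det_mul, ih, h1,
      ← Finset.prod_mul_distrib]
    simp

theorem trace_pow_eq_sum_eigenvalues (V : Matrix (Fin N) (Fin N) ℂ) (k : ℕ) :
    (V ^ k).trace = ∑ i, eigenvalues V i ^ k := by
  have h : (V ^ k).charpoly = ∏ i, (Polynomial.X - Polynomial.C (eigenvalues V i ^ k)) := by
    refine Polynomial.funext fun x => ?_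
    rw [Matrix.eval_charpoly, Polynomial.eval_prod]
    have := det_aeval_eq_prod V (Polynomial.C x - Polynomial.X ^ k)
    simpa [Matrix.algebraMap_eq_diagonal, Matrix.scalar_apply, Pi.algebraMap_def] using this
  have h2 := Polynomial.roots_multiset_prod_X_sub_C
    (Finset.univ.val.map fun i => eigenvalues V i ^ k)
  rw [Multiset.map_map] at h2
  rw [Matrix.trace_eq_sum_roots_charpoly, h]
  exact congrArg Multiset.sum h2

section
open scoped Matrix.Norms.L2Operator

theorem norm_eigenvalues (U : Matrix.unitaryGroup (Fin N) ℂ) (i : Fin N) :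
    ‖eigenvalues U.1 i‖ = 1 := by
  have h : eigenvalues U.1 i ∈ spectrum ℂ U.1 := by
    rw [Matrix.mem_spectrum_iff_isRoot_charpoly, charpoly_eq_prod_eigenvalues,
      Polynomial.IsRoot, Polynomial.eval_prod]
    exact Finset.prod_eq_zero (Finset.mem_univ i) (by simp)
  simpa using spectrum.subset_circle_of_unitary U.2 h

end

theorem powTrace_eq_sum (k : ℤ) (U : Matrix.unitaryGroup (Fin N) ℂ) :
    powTrace k U = ∑ i, eigenvalues U.1 i ^ k := by
  have h : ∀ n : ℕ, powTrace n U = ∑ i, eigenvalues U.1 i ^ n := fun n => by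
    rw [powTrace, zpow_natCast, SubmonoidClass.coe_pow, trace_pow_eq_sum_eigenvalues]
  obtain ⟨n, rfl | rfl⟩ := k.eq_nat_or_neg
  · simpa using h n
  · rw [powTrace_neg, h, star_sum]
    refine Finset.sum_congr rfl fun i _ => ?_
    rw [zpow_neg, zpow_natCast, star_pow, ← inv_pow]
    congr 1
    rw [Complex.inv_def, Complex.normSq_eq_norm_sq, norm_eigenvalues]
    simp

/-! ### The Weyl integration formula for class functions -/

/-- A class function together with its Laurent polynomial: power traces and power sums. -/
noncomputable def powPair (N : ℕ) (k : ℤ) :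
    (Matrix.unitaryGroup (Fin N) ℂ → ℂ) × Laurent N := (powTrace k, Laurent.psum N k)

/-- The algebra of class functions generated by power traces, with their Laurent polynomials. -/
noncomputable def classPairs (N : ℕ) :
    Subalgebra ℂ ((Matrix.unitaryGroup (Fin N) ℂ → ℂ) × Laurent N) :=
  Algebra.adjoin ℂ (Set.range (powPair N))

theorem powPair_mem (k : ℤ) : powPair N k ∈ classPairs N :=
  Algebra.subset_adjoin (Set.mem_range_self k)

theorem continuous_of_mem_classPairs {z} (hz : z ∈ classPairs N) : Continuous z.1 := by
  induction hz using Algebra.adjoin_induction with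
  | mem x hx => obtain ⟨k, rfl⟩ := hx; exact continuous_powTrace k
  | algebraMap r => exact continuous_const
  | add x y _ _ hx hy => exact hx.add hy
  | mul x y _ _ hx hy => exact hx.mul hy

/-- Evaluation of Laurent polynomials at the eigenvalues of a unitary matrix. -/
noncomputable def evalEigenvalues (U : Matrix.unitaryGroup (Fin N) ℂ) : Laurent N →ₐ[ℂ] ℂ :=
  AddMonoidAlgebra.lift ℂ ℂ (Fin N → ℤ)
    { toFun := fun ν => ∏ i, eigenvalues U.1 i ^ (Multiplicative.toAdd ν i)
      map_one' := by simp
      map_mul' := fun μ ν => by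
        rw [← Finset.prod_mul_distrib]
        refine Finset.prod_congr rfl fun i _ => ?_
        rw [toAdd_mul, Pi.add_apply, zpow_add₀]
        exact norm_ne_zero_iff.1 (by rw [norm_eigenvalues]; exact one_ne_zero) }

theorem evalEigenvalues_psum (U : Matrix.unitaryGroup (Fin N) ℂ) (k : ℤ) :
    evalEigenvalues U (Laurent.psum N k) = powTrace k U := by
  rw [powTrace_eq_sum, Laurent.psum, map_sum]
  refine Finset.sum_congr rfl fun i _ => ?_
  rw [evalEigenvalues, Laurent.xpow, AddMonoidAlgebra.lift_single, one_smul]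
  simp only [MonoidHom.coe_mk, OneHom.coe_mk, toAdd_ofAdd]
  rw [Finset.prod_eq_single i]
  · simp
  · intro j _ hj
    simp [hj]
  · simp

theorem evalEigenvalues_snd {z} (hz : z ∈ classPairs N) (U : Matrix.unitaryGroup (Fin N) ℂ) :
    evalEigenvalues U z.2 = z.1 U := by
  induction hz using Algebra.adjoin_induction with
  | mem x hx => obtain ⟨k, rfl⟩ := hx; exact evalEigenvalues_psum U k
  | algebraMap r =>
    rw [Prod.algebraMap_apply]
    exact (evalEigenvalues U).commutes r
  | add x y _ _ hx hy => simp [hx, hy]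
  | mul x y _ _ hx hy => simp [hx, hy]

theorem isAlternating_mul_vand {z} (hz : z ∈ classPairs N) :
    (z.2 * Laurent.vand N).IsAlternating := by
  -- Stated for all alternating `f`, so that in the product case the two factors can be applied in
  -- turn.
  have h : ∀ f : Laurent N, f.IsAlternating → (z.2 * f).IsAlternating := by
    induction hz using Algebra.adjoin_induction with
    | mem x hx => obtain ⟨k, rfl⟩ := hx; exact fun f hf => hf.psum_mul k
    | algebraMap r =>
      intro f hf σ ν
      rw [Prod.algebraMap_apply]
      simp only [← Algebra.smul_def, AddMonoidAlgebra.coeff_smul_apply, hf σ ν, smul_eq_mul]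
      ring
    | add x y _ _ hx hy =>
      intro f hf σ ν
      rw [Prod.snd_add, add_mul]
      simp only [AddMonoidAlgebra.coeff_add, Finsupp.add_apply, hx f hf σ ν, hy f hf σ ν]
      ring
    | mul x y _ _ hx hy =>
      intro f hf
      rw [Prod.snd_mul, mul_assoc]
      exact hx _ (hy _ hf)
  exact h _ Laurent.isAlternating_vand

theorem map_loopTerm {A B ι : Type*} [CommRing A] [Algebra ℂ A] [CommRing B] [Algebra ℂ B]
    [DecidableEq ι] (φ : A →ₐ[ℂ] B) (p : ℤ → A) (k : ι → ℤ) (s : Finset ι) (m : ℤ) :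
    φ (loopTerm p k s m) = loopTerm (fun l => φ (p l)) k s m := by
  have h : φ (loopSum p m) = loopSum (fun l => φ (p l)) m := by
    cases m <;> simp [loopSum]
  simp [loopTerm, h]

theorem loopTerm_powPair_snd {ι : Type*} [DecidableEq ι] (k : ι → ℤ) (s : Finset ι) (m : ℤ) :
    (loopTerm (powPair N) k s m).2 = loopTerm (Laurent.psum N) k s m := by
  have h := map_loopTerm (AlgHom.snd ℂ (Matrix.unitaryGroup (Fin N) ℂ → ℂ) (Laurent N))
    (powPair N) k s m
  rw [AlgHom.snd_apply] at h
  rw [h]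
  rfl

theorem loopTerm_powPair_fst {ι : Type*} [DecidableEq ι] (k : ι → ℤ) (s : Finset ι) (m : ℤ)
    (U : Matrix.unitaryGroup (Fin N) ℂ) :
    (loopTerm (powPair N) k s m).1 U = loopTerm (fun l => powTrace l U) k s m := by
  have h := map_loopTerm ((Pi.evalAlgHom ℂ (fun _ : Matrix.unitaryGroup (Fin N) ℂ => ℂ) U).comp
    (AlgHom.fst ℂ (Matrix.unitaryGroup (Fin N) ℂ → ℂ) (Laurent N))) (powPair N) k s m
  rw [AlgHom.comp_apply, AlgHom.fst_apply, Pi.evalAlgHom_apply] at h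
  rw [h]
  rfl

theorem loopTerm_mem {A ι : Type*} [CommRing A] [Algebra ℂ A] [DecidableEq ι]
    (S : Subalgebra ℂ A) {p : ℤ → A} (hp : ∀ l, p l ∈ S) (k : ι → ℤ) (s : Finset ι) (m : ℤ) :
    loopTerm p k s m ∈ S := by
  have h : loopSum p m ∈ S := by
    cases m
    · exact sum_mem fun b _ => mul_mem (hp _) (hp _)
    · exact neg_mem (sum_mem fun b _ => mul_mem (hp _) (hp _))
  exact add_mem (mul_mem h (prod_mem fun r _ => hp _)) (sum_mem fun r _ =>
    S.smul_mem (mul_mem (hp _) (prod_mem fun r _ => hp _)) _)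

theorem exists_prod_powPair {z} (hz : z ∈ Submonoid.closure (Set.range (powPair N))) :
    ∃ (n : ℕ) (k : Fin n → ℤ), z = ∏ r, powPair N (k r) := by
  induction hz using Submonoid.closure_induction with
  | mem x hx => obtain ⟨k, rfl⟩ := hx; exact ⟨1, fun _ => k, by simp⟩
  | one => exact ⟨0, Fin.elim0, by simp⟩
  | mul x y _ _ hx hy =>
    obtain ⟨n, k, rfl⟩ := hx
    obtain ⟨m, l, rfl⟩ := hy
    exact ⟨n + m, Fin.append k l, by simp [Fin.prod_univ_add]⟩

/-- The Casimir operator minus the staircase energy preserves the algebra of class functions, and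
its image has integral zero. On products of power traces this is the loop equation; the rest is
linearity, since the algebra is the span of such products. -/
theorem exists_radialCasimir {z} (hz : z ∈ classPairs N) :
    ∃ z' ∈ classPairs N, z'.2 * Laurent.vand N =
      Laurent.radialCasimir (z.2 * Laurent.vand N) -
        (Laurent.weightEnergy (Laurent.stair N) : ℂ) • (z.2 * Laurent.vand N) ∧
      ∫ U, z'.1 U ∂(haarUnitary N) = 0 := by
  have hz' : z ∈ Submodule.span ℂ (Submonoid.closure (Set.range (powPair N)) : Set _) := by
    rw [← Algebra.adjoin_eq_span]; exact hz
  clear hz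
  induction hz' using Submodule.span_induction with
  | mem x hx =>
    obtain ⟨n, k, rfl⟩ := exists_prod_powPair hx
    have hmem : ∀ r, loopTerm (powPair N) k (Finset.univ.erase r) (k r) ∈ classPairs N :=
      fun r => loopTerm_mem _ powPair_mem _ _ _
    refine ⟨(4 : ℂ) • ∑ r, (k r : ℂ) • loopTerm (powPair N) k (Finset.univ.erase r) (k r),
      Subalgebra.smul_mem _ (sum_mem fun r _ => Subalgebra.smul_mem _ (hmem r) _) _, ?_, ?_⟩
    · have h1 : (∏ r, powPair N (k r)).2 = ∏ r, Laurent.psum N (k r) :=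
        map_prod (RingHom.snd _ _) _ _
      rw [h1, Laurent.radialCasimir_prod_psum_mul_vand, add_sub_cancel_left, Prod.smul_snd,
        Prod.snd_sum, smul_mul_assoc]
      simp only [Prod.smul_snd, loopTerm_powPair_snd]
    · simp only [Prod.smul_fst, Prod.fst_sum, Pi.smul_apply, Finset.sum_apply, smul_eq_mul]
      rw [integral_const_mul, integral_finsetSum]
      · simp only [integral_const_mul, loopTerm_powPair_fst, integral_loopTerm]
        simp
      · exact fun r _ => (integrable_of_continuous
          (continuous_of_mem_classPairs (hmem r))).const_mul _
  | zero => exact ⟨0, zero_mem _, by ext; simp [Laurent.coeff_radialCasimir], by simp⟩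
  | add x y _ _ hx hy =>
    obtain ⟨x', hx1, hx2, hx3⟩ := hx
    obtain ⟨y', hy1, hy2, hy3⟩ := hy
    refine ⟨x' + y', add_mem hx1 hy1, ?_, ?_⟩
    · rw [Prod.snd_add, add_mul, hx2, hy2]
      ext ν
      simp only [AddMonoidAlgebra.coeff_add, AddMonoidAlgebra.coeff_sub, Finsupp.add_apply,
        Finsupp.sub_apply, Laurent.coeff_radialCasimir, AddMonoidAlgebra.coeff_smul_apply,
        Prod.snd_add, add_mul, smul_eq_mul]
      ring
    · simp only [Prod.fst_add, Pi.add_apply]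
      rw [integral_add (integrable_of_continuous (continuous_of_mem_classPairs hx1))
        (integrable_of_continuous (continuous_of_mem_classPairs hy1)), hx3, hy3, add_zero]
  | smul a x _ hx =>
    obtain ⟨x', hx1, hx2, hx3⟩ := hx
    refine ⟨a • x', Subalgebra.smul_mem _ hx1 _, ?_, ?_⟩
    · rw [Prod.smul_snd, smul_mul_assoc, hx2]
      ext ν
      simp only [AddMonoidAlgebra.coeff_sub, AddMonoidAlgebra.coeff_smul_apply,
        Finsupp.sub_apply, Laurent.coeff_radialCasimir, 
        Prod.smul_snd, smul_mul_assoc, smul_eq_mul]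
      ring
    · simp only [Prod.smul_fst, Pi.smul_apply, smul_eq_mul]
      rw [integral_const_mul, hx3, mul_zero]

/-- Applies the polynomial `∏ (T - l)` in the centred Casimir operator `T`. As `T` has integral zero
on class functions, each factor multiplies the integral by `-l`. -/
theorem exists_prod_radialCasimir {z} (hz : z ∈ classPairs N) (Λ : Finset ℤ) :
    ∃ z' ∈ classPairs N, (∀ ν, (z'.2 * Laurent.vand N).coeff ν =
      (∏ l ∈ Λ, ((Laurent.weightEnergy ν - Laurent.weightEnergy (Laurent.stair N) - l : ℤ) : ℂ)) *
        (z.2 * Laurent.vand N).coeff ν) ∧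
      ∫ U, z'.1 U ∂(haarUnitary N) = (∏ l ∈ Λ, ((-l : ℤ) : ℂ)) * ∫ U, z.1 U ∂(haarUnitary N) := by
  induction Λ using Finset.induction_on with
  | empty => exact ⟨z, hz, by simp, by simp⟩
  | insert l Λ hl ih =>
    obtain ⟨x, hx, hx1, hx2⟩ := ih
    obtain ⟨y, hy, hy1, hy2⟩ := exists_radialCasimir hx
    refine ⟨y - (l : ℂ) • x, sub_mem hy (Subalgebra.smul_mem _ hx _), fun ν => ?_, ?_⟩
    · rw [Prod.snd_sub, sub_mul, hy1, Finset.prod_insert hl]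
      simp only [AddMonoidAlgebra.coeff_sub, AddMonoidAlgebra.coeff_smul_apply,
        Finsupp.sub_apply, Laurent.coeff_radialCasimir, 
        Prod.smul_snd, smul_mul_assoc, smul_eq_mul, hx1]
      push_cast
      ring
    · simp only [Prod.fst_sub, Pi.sub_apply, Prod.smul_fst, Pi.smul_apply, smul_eq_mul]
      rw [integral_sub (integrable_of_continuous (continuous_of_mem_classPairs hy))
        ((integrable_of_continuous (continuous_of_mem_classPairs hx)).const_mul _),
        integral_const_mul, hy2, hx2, Finset.prod_insert hl]
      push_cast
      ring

/-- The Haar integral of a class function is the constant term prescribed by the Weyl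
integration formula. -/
theorem integral_classPairs {z} (hz : z ∈ classPairs N) :
    ∫ U, z.1 U ∂(haarUnitary N) = (z.2 * Laurent.vand N).coeff (Laurent.stair N) := by
  classical
  set w := z.2 * Laurent.vand N with hw
  -- The nonzero energy gaps that occur in `w`. The corresponding product annihilates every monomial
  -- whose energy differs from that of the staircase and multiplies the others by `K ≠ 0`.
  set Λ : Finset ℤ := (w.coeff.support.image fun ν =>
    Laurent.weightEnergy ν - Laurent.weightEnergy (Laurent.stair N)).erase 0 with hΛ
  obtain ⟨x, hx, hx1, hx2⟩ := exists_prod_radialCasimir hz Λ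
  rw [← hw] at hx1
  set K : ℂ := ∏ l ∈ Λ, ((-l : ℤ) : ℂ) with hK
  have hK0 : K ≠ 0 := by
    rw [hK, Finset.prod_ne_zero_iff]
    intro l hl
    have : l ≠ 0 := Finset.ne_of_mem_erase hl
    simpa using this
  have halt : w.IsAlternating := isAlternating_mul_vand hz
  -- An alternating polynomial lives on injective weights, and the injective weights of staircase
  -- energy are permutations of the staircase; hence only a multiple of the Vandermonde determinant
  -- survives.
  have hxv : x.2 * Laurent.vand N =
      algebraMap ℂ _ (K * w.coeff (Laurent.stair N)) * Laurent.vand N := by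
    ext ν
    rw [hx1, ← Algebra.smul_def, AddMonoidAlgebra.coeff_smul_apply, smul_eq_mul]
    by_cases hν : ∃ σ : Equiv.Perm (Fin N), ν = Laurent.stair N ∘ σ
    · obtain ⟨σ, rfl⟩ := hν
      rw [halt, Laurent.coeff_vand_perm, Laurent.weightEnergy_comp_perm]
      simp only [sub_self, zero_sub, ← hK]
      ring
    · have h1 : (Laurent.vand N).coeff ν = 0 := by
        by_contra h
        exact hν (Laurent.exists_perm_of_coeff_vand_ne_zero h)
      rw [h1, mul_zero]
      by_cases h2 : w.coeff ν = 0
      · rw [h2, mul_zero]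
      have h3 : Function.Injective ν := by
        intro i j hij
        by_contra h
        exact h2 (halt.coeff_eq_zero h hij)
      rw [Finset.prod_eq_zero (i := Laurent.weightEnergy ν -
        Laurent.weightEnergy (Laurent.stair N)), zero_mul]
      · refine Finset.mem_erase.2 ⟨?_, Finset.mem_image_of_mem _ (Finsupp.mem_support_iff.2 h2)⟩
        intro h
        exact hν (Laurent.exists_perm_of_weightEnergy_eq h3 (sub_eq_zero.1 h))
      · simp
  -- After cancellation the symmetric Laurent polynomial of `x` is a constant, so `x` itself is a
  -- constant function and its integral is its value.
  have hx3 := mul_right_cancel₀ Laurent.vand_ne_zero hxv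
  have hx4 : ∀ U, x.1 U = K * w.coeff (Laurent.stair N) := by
    intro U
    rw [← evalEigenvalues_snd hx, hx3]
    exact (evalEigenvalues U).commutes _
  simp only [hx4] at hx2
  rw [integral_const] at hx2
  simp only [probReal_univ, one_smul] at hx2
  exact (mul_left_cancel₀ hK0 hx2).symm

end CUESchur

namespace CUESchur

/-! ### Second and fourth moments of power traces -/

namespace Laurent

variable {N : ℕ}

theorem coeff_vand_eq_zero_of_le {ν : Fin N → ℤ} {a : Fin N} (h : (N : ℤ) ≤ ν a) :
    (vand N).coeff ν = 0 := by
  by_contra h'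
  obtain ⟨σ, rfl⟩ := exists_perm_of_coeff_vand_ne_zero h'
  simp only [Function.comp, stair] at h
  have := (σ a).2
  omega

/-- A permutation fixing every index other than `a` and `b` is the identity or their transposition,
which accounts for the two signed indicators. -/
theorem coeff_vand_of_eq_off_pair {ν : Fin N → ℤ} {a b : Fin N} (hab : a ≠ b)
    (hν : ∀ i, i ≠ a → i ≠ b → ν i = stair N i) :
    (vand N).coeff ν = (((if ν a = stair N a ∧ ν b = stair N b then 1 else 0) -
      (if ν a = stair N b ∧ ν b = stair N a then 1 else 0) : ℤ) : ℂ) := by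
  have hne : stair N a ≠ stair N b := fun h => hab (stair_injective h)
  by_cases h1 : ν a = stair N a ∧ ν b = stair N b
  · have : ν = stair N := by
      funext i
      by_cases hia : i = a
      · rw [hia, h1.1]
      by_cases hib : i = b
      · rw [hib, h1.2]
      exact hν i hia hib
    rw [if_pos h1, if_neg (fun h2 => hne (h1.1.symm.trans h2.1)), this, coeff_vand_stair]
    simp
  by_cases h2 : ν a = stair N b ∧ ν b = stair N a
  · have : ν = stair N ∘ Equiv.swap a b := by
      funext i
      by_cases hia : i = a
      · simp [hia, h2.1]
      by_cases hib : i = b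
      · simp [hib, h2.2]
      simp [Equiv.swap_apply_of_ne_of_ne hia hib, hν i hia hib]
    rw [if_neg h1, if_pos h2, this, coeff_vand_perm, Equiv.Perm.sign_swap hab]
    simp
  rw [if_neg h1, if_neg h2, sub_self, Int.cast_zero]
  by_contra h3
  obtain ⟨σ, rfl⟩ := exists_perm_of_coeff_vand_ne_zero h3
  have hfix : ∀ i, i ≠ a → i ≠ b → σ i = i := fun i hia hib => stair_injective (hν i hia hib)
  have hmem : ∀ c, (c = a ∨ c = b) → (σ c = a ∨ σ c = b) := by
    intro c hc
    by_contra! h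
    have := σ.injective (hfix (σ c) h.1 h.2)
    rw [this] at h
    exact hc.elim h.1 h.2
  simp only [Function.comp] at h1 h2
  rcases hmem a (Or.inl rfl) with ha | ha <;> rcases hmem b (Or.inr rfl) with hb | hb
  · exact hab (σ.injective (ha.trans hb.symm))
  · exact h1 ⟨by rw [ha], by rw [hb]⟩
  · exact h2 ⟨by rw [ha], by rw [hb]⟩
  · exact hab (σ.injective (ha.trans hb.symm))

/-- The weight `(0, …, N - 1)` with entry `r` raised by `m` and entry `s` raised by `n`. -/
def raised (m n : ℤ) (r s : Fin N) : Fin N → ℤ := stair N + Pi.single r m + Pi.single s n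

theorem raised_apply (m n : ℤ) (r s i : Fin N) : raised m n r s i =
    (i : ℕ) + (if i = r then m else 0) + (if i = s then n else 0) := by
  simp [raised, stair, Pi.single_apply]

/-- The amplitude of a single particle-hole excitation. -/
def amplitude (N m n r : ℕ) : ℤ :=
  1 - (if r + m < N then 1 else 0) - (if r + n < N then 1 else 0)

theorem sum_fin_ite {A : Type*} [AddCommMonoid A] (c : A) (m : ℕ) (r : Fin N) :
    ∑ s : Fin N, (if (s : ℕ) = r + m then c else 0) = if (r : ℕ) + m < N then c else 0 := by
  split_ifs with h
  · rw [Finset.sum_eq_single ⟨r + m, h⟩]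
    · simp
    · intro s _ hs
      exact if_neg fun h' => hs (Fin.ext h')
    · simp
  · refine Finset.sum_eq_zero fun s _ => if_neg fun h' => ?_
    have := s.2
    omega

/-- If `r ≠ s` and one raised entry stays below `N`, it either collides with an untouched entry, and
the coefficient vanishes, or lands where the other raised entry stood. In that case a transposition
makes the weight a doubly raised one, with a sign. -/
theorem IsAlternating.coeff_raised {v : Laurent N} (hv : v.IsAlternating) {m n : ℕ} (hm : 0 < m)
    (hn : 0 < n) (r s : Fin N) :
    v.coeff (raised m n r s) =
      (if r = s then v.coeff (raised m n r r) else 0) +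
      (if r ≠ s ∧ N ≤ r + m ∧ N ≤ s + n then v.coeff (raised m n r s) else 0) -
      (if (s : ℕ) = r + m then v.coeff (raised m n r r) else 0) -
      (if (r : ℕ) = s + n then v.coeff (raised m n s s) else 0) := by
  by_cases hrs : r = s
  · subst hrs
    simp [hm.ne', hn.ne']
  have hrs' : (r : ℕ) ≠ s := fun h => hrs (Fin.ext h)
  have hswap : ∀ ν μ : Fin N → ℤ, μ = ν ∘ Equiv.swap r s → v.coeff ν = -v.coeff μ := by
    rintro ν μ rfl
    rw [hv, Equiv.Perm.sign_swap hrs]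
    simp
  rw [if_neg hrs]
  by_cases h1 : (s : ℕ) = r + m
  · rw [if_neg (by omega), if_pos h1, if_neg (by omega)]
    rw [hswap (raised m n r s) (raised m n r r)]
    · ring
    · funext i
      simp only [raised_apply, Function.comp]
      by_cases hir : i = r
      · subst hir; simp [Ne.symm hrs]; omega
      by_cases his : i = s
      · subst his; simp [hrs, Ne.symm hrs]; omega
      simp [Equiv.swap_apply_of_ne_of_ne hir his, hir, his]
  by_cases h2 : (r : ℕ) = s + n
  · rw [if_neg (by omega), if_neg h1, if_pos h2]
    rw [hswap (raised m n r s) (raised m n s s)]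
    · ring
    · funext i
      simp only [raised_apply, Function.comp]
      by_cases hir : i = r
      · subst hir; simp [hrs, Ne.symm hrs]; omega
      by_cases his : i = s
      · subst his; simp [hrs]; omega
      simp [Equiv.swap_apply_of_ne_of_ne hir his, hir, his]
  rw [if_neg h1, if_neg h2]
  by_cases h3 : N ≤ r + m ∧ N ≤ s + n
  · simp [hrs, h3]
  rw [if_neg (fun h => h3 h.2)]
  simp only [sub_zero, add_zero]
  rw [not_and_or, not_le, not_le] at h3
  rcases h3 with h3 | h3
  · have hr : (⟨r + m, h3⟩ : Fin N) ≠ r := fun h => by simp [Fin.ext_iff] at h; omega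
    have hs : (⟨r + m, h3⟩ : Fin N) ≠ s := fun h => by simp [Fin.ext_iff] at h; omega
    refine hv.coeff_eq_zero hr ?_
    simp [raised_apply, hr, hs, hrs]
  · have hr : (⟨s + n, h3⟩ : Fin N) ≠ r := fun h => by simp [Fin.ext_iff] at h; omega
    have hs : (⟨s + n, h3⟩ : Fin N) ≠ s := fun h => by simp [Fin.ext_iff] at h; omega
    refine hv.coeff_eq_zero hs ?_
    simp [raised_apply, hr, hs, Ne.symm hrs]

theorem IsAlternating.sum_coeff_raised {v : Laurent N} (hv : v.IsAlternating) {m n : ℕ}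
    (hm : 0 < m) (hn : 0 < n) :
    ∑ r, ∑ s, v.coeff (raised m n r s) =
      ∑ r : Fin N, (amplitude N m n r : ℂ) * v.coeff (raised m n r r) +
      ∑ r : Fin N, ∑ s : Fin N,
        if r ≠ s ∧ N ≤ r + m ∧ N ≤ s + n then v.coeff (raised m n r s) else 0 := by
  rw [Finset.sum_congr rfl fun r _ => Finset.sum_congr rfl fun s _ => hv.coeff_raised hm hn r s]
  simp only [Finset.sum_sub_distrib, Finset.sum_add_distrib, sum_fin_ite]
  rw [Finset.sum_comm (f := fun r s : Fin N => if (r : ℕ) = s + n then _ else (0 : ℂ))]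
  simp only [sum_fin_ite, Finset.sum_ite_eq, Finset.mem_univ, if_true]
  rw [sub_sub, add_sub_right_comm, ← Finset.sum_add_distrib, ← Finset.sum_sub_distrib]
  congr 1
  refine Finset.sum_congr rfl fun r _ => ?_
  rw [amplitude]
  split_ifs <;> push_cast <;> ring

theorem coeff_psum_mul_psum_mul (m n : ℤ) (f : Laurent N) (ν : Fin N → ℤ) :
    (psum N m * (psum N n * f)).coeff ν =
      ∑ t, ∑ u, f.coeff (ν - Pi.single t m - Pi.single u n) := by
  simp only [coeff_psum_mul]

theorem sum_sum_eq_of_ne {A ι : Type*} [AddCommGroup A] [Fintype ι] [DecidableEq ι]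
    (F : ι → ι → A) (r : ι) (h : ∀ t u, t ≠ r → u ≠ r → F t u = 0) :
    ∑ t, ∑ u, F t u = F r r + ∑ u, (if u = r then 0 else F r u) +
      ∑ t, (if t = r then 0 else F t r) := by
  have h1 : ∀ t u, F t u = (if t = r then if u = r then F r r else 0 else 0) +
      (if t = r then (if u = r then 0 else F r u) else 0) +
      (if u = r then (if t = r then 0 else F t r) else 0) := by
    intro t u
    by_cases ht : t = r <;> by_cases hu : u = r <;> simp [ht, hu]
    exact h t u ht hu
  rw [Finset.sum_congr rfl fun t _ => Finset.sum_congr rfl fun u _ => h1 t u]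
  simp only [Finset.sum_add_distrib]
  simp

/-- When `r + m + n ≥ N`, entry `r` must be lowered to return to a permutation of the staircase.
Lowering it twice gives `1`; lowering it once and entry `r + m` or `r + n` as well gives `-1`, if
that index exists. When `r + m + n < N` two entries coincide. -/
theorem coeff_psum_psum_vand_diag {m n : ℕ} (hm : 0 < m) (hn : 0 < n) (r : Fin N) :
    (psum N m * (psum N n * vand N)).coeff (raised m n r r) =
      ((if N ≤ r + m + n then amplitude N m n r else 0 : ℤ) : ℂ) := by
  split_ifs with h
  · rw [coeff_psum_mul_psum_mul, sum_sum_eq_of_ne _ r]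
    · have h1 : (vand N).coeff (raised m n r r - Pi.single r (m : ℤ) - Pi.single r (n : ℤ)) = 1 := by
        rw [show raised m n r r - Pi.single r (m : ℤ) - Pi.single r (n : ℤ) = stair N by
          rw [raised]; abel, coeff_vand_stair]
      have h2 : ∀ u : Fin N, (if u = r then 0 else (vand N).coeff
          (raised m n r r - Pi.single r (m : ℤ) - Pi.single u (n : ℤ))) =
          if (u : ℕ) = r + n then -1 else 0 := by
        intro u
        by_cases hu : u = r
        · subst hu; simp [hn.ne']
        rw [if_neg hu, coeff_vand_of_eq_off_pair (Ne.symm hu)]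
        · simp only [Pi.sub_apply, raised_apply, Pi.single_apply, stair, if_true, hu,
            Ne.symm hu, if_false]
          rw [if_neg (by omega)]
          by_cases h3 : (u : ℕ) = r + n
          · rw [if_pos (by omega), if_pos h3]; simp
          · rw [if_neg (by omega), if_neg h3]; simp
        · intro i hir hiu
          simp [raised_apply, hir, hiu, stair]
      have h3 : ∀ t : Fin N, (if t = r then 0 else (vand N).coeff
          (raised m n r r - Pi.single t (m : ℤ) - Pi.single r (n : ℤ))) =
          if (t : ℕ) = r + m then -1 else 0 := by
        intro u
        by_cases hu : u = r
        · subst hu; simp [hm.ne']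
        rw [if_neg hu, coeff_vand_of_eq_off_pair (Ne.symm hu)]
        · simp only [Pi.sub_apply, raised_apply, Pi.single_apply, stair, if_true, hu,
            Ne.symm hu, if_false]
          rw [if_neg (by omega)]
          by_cases h3 : (u : ℕ) = r + m
          · rw [if_pos (by omega), if_pos h3]; simp
          · rw [if_neg (by omega), if_neg h3]; simp
        · intro i hir hiu
          simp [raised_apply, hir, hiu, stair]
      simp only [h1, h2, h3, sum_fin_ite, amplitude]
      split_ifs <;> norm_num
    · intro t u ht hu
      refine coeff_vand_eq_zero_of_le (a := r) ?_
      simp only [Pi.sub_apply, raised_apply, Pi.single_apply, if_true, Ne.symm ht, Ne.symm hu,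
        if_false]
      omega
  · rw [Int.cast_zero]
    have hr : (⟨r + m + n, not_le.1 h⟩ : Fin N) ≠ r := fun h => by
      simp [Fin.ext_iff] at h; omega
    refine ((isAlternating_vand.psum_mul _).psum_mul _).coeff_eq_zero hr ?_
    simp [raised_apply, hr]

/-- Both raised entries are at least `N`, so each must be lowered once. Lowering each by its own
amount gives `1`; exchanging the amounts gives the other two indicators. -/
theorem coeff_psum_psum_vand_pair {m n : ℕ} (r s : Fin N) (hrs : r ≠ s)
    (hr : N ≤ r + m) (hs : N ≤ s + n) :
    (psum N m * (psum N n * vand N)).coeff (raised m n r s) =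
      ((1 + (if m = n then 1 else 0) - (if (r : ℕ) + m = s + n then 1 else 0) : ℤ) : ℂ) := by
  have hsr := Ne.symm hrs
  have hrs' : (r : ℕ) ≠ s := fun h => hrs (Fin.ext h)
  have h0 : ∀ t u, ¬ ((t = r ∧ u = s) ∨ (t = s ∧ u = r)) → (vand N).coeff
      (raised m n r s - Pi.single t (m : ℤ) - Pi.single u (n : ℤ)) = 0 := by
    intro t u h
    by_cases h1 : t ≠ r ∧ u ≠ r
    · refine coeff_vand_eq_zero_of_le (a := r) ?_
      simp only [Pi.sub_apply, raised_apply, Pi.single_apply, if_true, Ne.symm h1.1,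
        Ne.symm h1.2, hrs, if_false]
      omega
    · refine coeff_vand_eq_zero_of_le (a := s) ?_
      have h2 : s ≠ t := by
        rintro rfl
        by_cases h3 : u = r
        · exact h (Or.inr ⟨rfl, h3⟩)
        · exact h1 ⟨hsr, h3⟩
      have h3 : s ≠ u := by
        rintro rfl
        by_cases h3 : t = r
        · exact h (Or.inl ⟨h3, rfl⟩)
        · exact h1 ⟨h3, hsr⟩
      simp only [Pi.sub_apply, raised_apply, Pi.single_apply, if_true, h2, h3, hsr, if_false]
      omega
  have h1 : (vand N).coeff (raised m n r s - Pi.single r (m : ℤ) - Pi.single s (n : ℤ)) = 1 := by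
    rw [show raised m n r s - Pi.single r (m : ℤ) - Pi.single s (n : ℤ) = stair N by
      rw [raised]; abel, coeff_vand_stair]
  have h2 : (vand N).coeff (raised m n r s - Pi.single s (m : ℤ) - Pi.single r (n : ℤ)) =
      (((if m = n then 1 else 0) - (if (r : ℕ) + m = s + n then 1 else 0) : ℤ) : ℂ) := by
    rw [coeff_vand_of_eq_off_pair hrs]
    · simp only [Pi.sub_apply, raised_apply, Pi.single_apply, stair, if_true, hrs, hsr, if_false]
      congr 3
      · exact propext (by omega)
      · exact propext (by omega)
    · intro i hir his
      simp [raised_apply, hir, his, stair]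
  rw [coeff_psum_mul_psum_mul]
  refine (Fintype.sum_prod_type' (fun t u => (vand N).coeff
    (raised m n r s - Pi.single t (m : ℤ) - Pi.single u (n : ℤ)))).symm.trans ?_
  rw [Finset.sum_eq_add (r, s) (s, r)]
  · simp only [h1, h2]
    push_cast
    ring
  · simp [hrs]
  · rintro ⟨t, u⟩ _ ⟨h3, h4⟩
    refine h0 t u ?_
    rintro (⟨rfl, rfl⟩ | ⟨rfl, rfl⟩)
    · exact h3 rfl
    · exact h4 rfl
  · simp
  · simp

/-- The value of the mixed moment of `|Tr U ^ m|²` and `|Tr U ^ n|²`. -/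
def mixedMoment (N m n : ℕ) : ℤ :=
  ∑ r : Fin N, (if N ≤ r + m + n then amplitude N m n r ^ 2 else 0) +
  ∑ r : Fin N, ∑ s : Fin N, if r ≠ s ∧ N ≤ r + m ∧ N ≤ s + n then
    (1 + (if m = n then 1 else 0) - (if (r : ℕ) + m = s + n then 1 else 0)) else 0

theorem coeff_mixedMoment {m n : ℕ} (hm : 0 < m) (hn : 0 < n) :
    (psum N (-m) * (psum N (-n) * (psum N m * (psum N n * vand N)))).coeff (stair N) =
      (mixedMoment N m n : ℂ) := by
  rw [coeff_psum_mul_psum_mul]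
  have h : ∀ r s : Fin N, stair N - Pi.single r (-(m : ℤ)) - Pi.single s (-(n : ℤ)) =
      raised m n r s := fun r s => by
    rw [Pi.single_neg, Pi.single_neg, sub_neg_eq_add, sub_neg_eq_add, raised]
  simp only [h]
  rw [((isAlternating_vand.psum_mul _).psum_mul _).sum_coeff_raised hm hn, mixedMoment]
  simp only [coeff_psum_psum_vand_diag hm hn]
  push_cast
  congr 1
  · refine Finset.sum_congr rfl fun r _ => ?_
    split_ifs <;> ring
  · refine Finset.sum_congr rfl fun r _ => Finset.sum_congr rfl fun s _ => ?_
    by_cases h : r ≠ s ∧ N ≤ r + m ∧ N ≤ s + n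
    · rw [if_pos h, if_pos h, coeff_psum_psum_vand_pair r s h.1 h.2.1 h.2.2]
      push_cast
      rfl
    · rw [if_neg h, if_neg h]

/-- Counts the levels that a jump by `m` lifts to `N` or above; this is the source of `min m N`. -/
theorem sum_fin_le_add {R : Type*} [Semiring R] (m : ℕ) :
    ∑ r : Fin N, (if N ≤ (r : ℕ) + m then (1 : R) else 0) = (min m N : ℕ) := by
  rw [Fin.sum_univ_eq_sum_range (fun r => if N ≤ r + m then (1 : R) else 0), Finset.sum_boole]
  congr 1
  rw [show (Finset.range N).filter (fun r => N ≤ r + m) = Finset.Ico (N - m) N by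
    ext r; simp only [Finset.mem_filter, Finset.mem_range, Finset.mem_Ico]; omega]
  rw [Nat.card_Ico]
  omega

theorem coeff_secondMoment {m : ℕ} (hm : 0 < m) :
    (psum N (-m) * (psum N m * vand N)).coeff (stair N) = (min m N : ℕ) := by
  rw [coeff_psum_mul_psum_mul]
  have h : ∀ r : Fin N, ∑ t, (vand N).coeff (stair N - Pi.single r (-(m : ℤ)) -
      Pi.single t (m : ℤ)) = 1 - if (r : ℕ) + m < N then 1 else 0 := by
    intro r
    have h1 : ∀ t, (vand N).coeff (stair N - Pi.single r (-(m : ℤ)) - Pi.single t (m : ℤ)) =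
        (if t = r then 1 else 0) - if (t : ℕ) = r + m then 1 else 0 := by
      intro t
      by_cases ht : t = r
      · subst ht
        have : stair N - Pi.single t (-(m : ℤ)) - Pi.single t (m : ℤ) = stair N := by
          rw [Pi.single_neg]; abel
        rw [this, coeff_vand_stair]
        simp [hm.ne']
      rw [coeff_vand_of_eq_off_pair (Ne.symm ht)]
      · simp only [Pi.sub_apply, Pi.single_apply, stair, if_true, ht, Ne.symm ht, if_false]
        rw [if_neg (by omega)]
        by_cases h3 : (t : ℕ) = r + m
        · rw [if_pos (by omega), if_pos h3]; simp
        · rw [if_neg (by omega), if_neg h3]; simp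
      · intro i hir hit
        simp [hir, hit]
    simp only [h1, Finset.sum_sub_distrib, sum_fin_ite]
    simp
  simp only [h]
  have h2 : ∀ r : Fin N, (1 - if (r : ℕ) + m < N then 1 else 0 : ℂ) =
      if N ≤ (r : ℕ) + m then 1 else 0 := by
    intro r
    by_cases h3 : (r : ℕ) + m < N
    · simp [h3]
    · simp [h3, not_lt.1 h3]
  simp only [h2]
  exact sum_fin_le_add m

end Laurent
end CUESchur

/-! ### Bounds on the covariances of squared power traces -/

namespace CUESchur

variable {N : ℕ}

namespace Laurent

theorem sum_amplitude_sq_le (N m n : ℕ) :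
    ∑ r : Fin N, (if N ≤ r + m + n then amplitude N m n r ^ 2 else 0) ≤ 2 * (m : ℤ) := by
  -- The squared amplitude is `1` exactly when `r + m` and `r + n` lie on the same side of `N`. The
  -- right side is chosen to telescope to `min m N + min (m + n) N - min n N`, which is at most `2
  -- m`.
  have h1 : ∀ r : Fin N, (if N ≤ r + m + n then amplitude N m n r ^ 2 else 0) ≤
      (if N ≤ (r : ℕ) + m then 1 else 0) +
      ((if N ≤ (r : ℕ) + (m + n) then 1 else 0) - (if N ≤ (r : ℕ) + n then (1 : ℤ) else 0)) := by
    intro r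
    unfold amplitude
    split_ifs <;> omega
  refine (Finset.sum_le_sum fun r _ => h1 r).trans ?_
  rw [Finset.sum_add_distrib, Finset.sum_sub_distrib, sum_fin_le_add, sum_fin_le_add,
    sum_fin_le_add]
  omega

theorem sum_amplitude_sq_le_min (N m n : ℕ) :
    ∑ r : Fin N, (if N ≤ r + m + n then amplitude N m n r ^ 2 else 0) ≤ 2 * (min m n : ℕ) := by
  rcases le_total m n with h | h
  · rw [min_eq_left h]
    exact sum_amplitude_sq_le N m n
  · rw [min_eq_right h]
    refine le_of_eq_of_le (Finset.sum_congr rfl fun r _ => ?_) (sum_amplitude_sq_le N n m)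
    rw [amplitude, amplitude, add_right_comm, sub_right_comm]

/-- In the pair sum the negative indicator and the restriction `r ≠ s` are dropped. What remains for
`m ≠ n` is the product of the two means, which cancels in the covariance. -/
theorem mixedMoment_le (N m n : ℕ) :
    mixedMoment N m n ≤ 2 * (min m n : ℕ) +
      (1 + if m = n then 1 else 0) * ((min m N : ℕ) * (min n N : ℕ)) := by
  refine add_le_add (sum_amplitude_sq_le_min N m n) ?_
  rw [← sum_fin_le_add, ← sum_fin_le_add, Finset.sum_mul_sum, Finset.mul_sum]
  refine Finset.sum_le_sum fun r _ => ?_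
  rw [Finset.mul_sum]
  refine Finset.sum_le_sum fun s _ => ?_
  split_ifs <;> simp_all

end Laurent

/-- `|Tr U ^ m|²`. -/
noncomputable def sqTrace (m : ℕ) (U : Matrix.unitaryGroup (Fin N) ℂ) : ℝ := ‖powTrace m U‖ ^ 2

theorem continuous_sqTrace (m : ℕ) :
    Continuous (sqTrace m : Matrix.unitaryGroup (Fin N) ℂ → ℝ) :=
  (continuous_powTrace _).norm.pow 2

theorem sqTrace_nonneg (m : ℕ) (U : Matrix.unitaryGroup (Fin N) ℂ) : 0 ≤ sqTrace m U :=
  sq_nonneg _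

theorem sqTrace_le (m : ℕ) (U : Matrix.unitaryGroup (Fin N) ℂ) : sqTrace m U ≤ (N : ℝ) ^ 2 := by
  refine pow_le_pow_left₀ (norm_nonneg _) ?_ 2
  rw [powTrace_eq_sum]
  refine (norm_sum_le _ _).trans ?_
  simp [norm_eigenvalues]

theorem sqTrace_eq (m : ℕ) (U : Matrix.unitaryGroup (Fin N) ℂ) :
    (sqTrace m U : ℂ) = powTrace (-m) U * powTrace m U := by
  rw [sqTrace, powTrace_neg, Complex.ofReal_pow, ← Complex.conj_mul']
  rfl

theorem integral_sqTrace {m : ℕ} (hm : 0 < m) :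
    ∫ U, sqTrace m U ∂(haarUnitary N) = (min m N : ℕ) := by
  have h := integral_classPairs (mul_mem (powPair_mem (N := N) (-m)) (powPair_mem m))
  have h2 := Laurent.coeff_secondMoment (N := N) hm
  rw [← mul_assoc] at h2
  rw [show (powPair N (-m) * powPair N m).2 = Laurent.psum N (-m) * Laurent.psum N m from rfl,
    h2] at h
  have h3 : ∀ U, (powPair N (-m) * powPair N m).1 U = (sqTrace m U : ℂ) := fun U =>
    (sqTrace_eq m U).symm
  simp only [h3] at h
  rw [integral_complex_ofReal, ← Complex.ofReal_natCast] at h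
  exact Complex.ofReal_injective h

theorem integral_sqTrace_mul_sqTrace {m n : ℕ} (hm : 0 < m) (hn : 0 < n) :
    ∫ U, sqTrace m U * sqTrace n U ∂(haarUnitary N) = Laurent.mixedMoment N m n := by
  have h := integral_classPairs (mul_mem (powPair_mem (N := N) (-m)) (mul_mem (powPair_mem (-n))
    (mul_mem (powPair_mem m) (powPair_mem n))))
  have h2 := Laurent.coeff_mixedMoment (N := N) hm hn
  simp only [← mul_assoc] at h2
  rw [show (powPair N (-m) * (powPair N (-n) * (powPair N m * powPair N n))).2 =
    Laurent.psum N (-m) * (Laurent.psum N (-n) * (Laurent.psum N m * Laurent.psum N n)) from rfl]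
    at h
  simp only [← mul_assoc] at h
  rw [h2] at h
  have h3 : ∀ U, (powPair N (-m) * powPair N (-n) * powPair N m * powPair N n).1 U =
      ((sqTrace m U * sqTrace n U : ℝ) : ℂ) := fun U => by
    rw [Complex.ofReal_mul, sqTrace_eq, sqTrace_eq]
    change powTrace (-m) U * powTrace (-n) U * powTrace m U * powTrace n U = _
    ring
  simp only [h3] at h
  rw [integral_complex_ofReal, ← Complex.ofReal_intCast] at h
  exact Complex.ofReal_injective h

theorem memLp_of_continuous {F : Matrix.unitaryGroup (Fin N) ℂ → ℝ} (hF : Continuous F) :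
    MemLp F 2 (haarUnitary N) := by
  obtain ⟨C, hC⟩ := (isCompact_range hF).isBounded.exists_norm_le
  exact MemLp.of_bound hF.aestronglyMeasurable C
    (Eventually.of_forall fun U => hC _ (Set.mem_range_self U))

theorem covariance_sqTrace_le {m n : ℕ} (hm : 0 < m) (hn : 0 < n) :
    covariance (sqTrace m) (sqTrace n) (haarUnitary N) ≤
      2 * (min m n : ℕ) + if m = n then (m : ℝ) ^ 2 else 0 := by
  rw [covariance_eq_sub (memLp_of_continuous (continuous_sqTrace m))
    (memLp_of_continuous (continuous_sqTrace n)), integral_sqTrace hm, integral_sqTrace hn]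
  have h1 : ∫ U, (sqTrace m * sqTrace n : Matrix.unitaryGroup (Fin N) ℂ → ℝ) U ∂(haarUnitary N) = Laurent.mixedMoment N m n :=
    integral_sqTrace_mul_sqTrace hm hn
  rw [h1]
  have h2 : (Laurent.mixedMoment N m n : ℝ) ≤ _ := Int.cast_le.2 (Laurent.mixedMoment_le N m n)
  push_cast at h2
  split_ifs at h2 ⊢ with h
  · subst h
    have h3 : (min (m : ℝ) N) * min (m : ℝ) N ≤ (m : ℝ) ^ 2 := by
      rw [sq]
      have := min_le_left (m : ℝ) N
      gcongr
    push_cast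
    linarith
  · push_cast
    linarith

end CUESchur

namespace CUESchur

/-! ### The Cauchy determinant -/

section CauchyDet

variable {A : Type*} [CommRing A] {N : ℕ}

-- Division of the full product by `1 - y_j X` as a power series: its coefficients are convolved
-- with the powers of `y_j`.
open Polynomial in
theorem coeff_prod_erase (y : Fin N → A) (j : Fin N) (k : ℕ) :
    (∏ l ∈ Finset.univ.erase j, (1 - C (y l) * X)).coeff k =
      ∑ i ∈ Finset.range (k + 1), (∏ l, (1 - C (y l) * X)).coeff (k - i) * y j ^ i := by
  set P : A[X] := ∏ l ∈ Finset.univ.erase j, (1 - C (y l) * X)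
  have h : ∏ l, (1 - C (y l) * X) = P - X * (C (y j) * P) := by
    rw [← Finset.mul_prod_erase _ _ (Finset.mem_univ j)]
    ring
  rw [h]
  induction k with
  | zero => simp
  | succ k ih =>
    rw [Finset.sum_range_succ']
    simp only [Nat.add_sub_add_right, pow_succ]
    have h2 := congrArg (· * y j) ih
    simp only [Finset.sum_mul, mul_assoc] at h2
    rw [← h2]
    simp only [coeff_sub, coeff_X_mul, coeff_C_mul, Nat.sub_zero, pow_zero, mul_one]
    ring

open Polynomial in
theorem natDegree_prod_erase_lt (y : Fin N → A) (j : Fin N) :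
    (∏ l ∈ Finset.univ.erase j, (1 - C (y l) * X)).natDegree < N := by
  have h1 : ∀ l, (1 - C (y l) * X : A[X]).natDegree ≤ 1 := by
    intro l
    refine (natDegree_sub_le _ _).trans ?_
    rw [natDegree_one]
    exact max_le (Nat.zero_le _) ((natDegree_C_mul_le _ _).trans natDegree_X_le)
  refine (natDegree_prod_le _ _).trans_lt ?_
  refine (Finset.sum_le_card_nsmul _ _ 1 fun l _ => h1 l).trans_lt ?_
  rw [Finset.card_erase_of_mem (Finset.mem_univ j), Finset.card_univ, Fintype.card_fin]
  have := j.2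
  simp
  omega

open Polynomial in
/-- The Cauchy determinant. -/
theorem det_cauchy (x y : Fin N → A) (m : Matrix (Fin N) (Fin N) A)
    (hm : ∀ i j, m i j * (1 - x i * y j) = 1) :
    m.det * ∏ i, ∏ j, (1 - x i * y j) =
      (Matrix.vandermonde x).det * (Matrix.vandermonde y).det := by
  set q : ℕ → A := fun k => (∏ l, (1 - C (y l) * X)).coeff k with hq
  -- Row `i` of the matrix, multiplied by `∏ (1 - x_i y_l)`, consists of the values at `x_i` of the
  -- products with one factor omitted. Expanding these in powers of `x_i` factors the matrix as
  -- Vandermonde times the unitriangular `L` times transposed Vandermonde.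
  let L : Matrix (Fin N) (Fin N) A :=
    Matrix.of fun k i => if (i : ℕ) ≤ k then q (k - i) else 0
  have hL : L.det = 1 := by
    rw [Matrix.det_of_isLowerTriangular L]
    · refine Finset.prod_eq_one fun i _ => ?_
      simp [L, hq, coeff_zero_eq_eval_zero, eval_prod]
    · intro i j hij
      simp only [OrderDual.toDual_lt_toDual] at hij
      simp only [L, Matrix.of_apply]
      exact if_neg (not_le.2 hij)
  have h1 : (Matrix.of fun i j => (∏ j, (1 - x i * y j)) * m i j) =
      Matrix.vandermonde x * L * (Matrix.vandermonde y).transpose := by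
    ext i j
    have h2 : (∏ j, (1 - x i * y j)) * m i j =
        (∏ l ∈ Finset.univ.erase j, (1 - C (y l) * X)).eval (x i) := by
      rw [← Finset.mul_prod_erase _ _ (Finset.mem_univ j), eval_prod]
      have : ∏ l ∈ Finset.univ.erase j, (1 - C (y l) * X).eval (x i) =
          ∏ l ∈ Finset.univ.erase j, (1 - x i * y l) :=
        Finset.prod_congr rfl fun l _ => by
            rw [eval_sub, eval_one, eval_mul, eval_C, eval_X, mul_comm]
      rw [this]
      linear_combination (∏ l ∈ Finset.univ.erase j, (1 - x i * y l)) * hm i j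
    rw [Matrix.of_apply, h2, eval_eq_sum_range' (natDegree_prod_erase_lt y j), mul_assoc,
      Matrix.mul_apply, Finset.sum_range]
    refine Finset.sum_congr rfl fun k _ => ?_
    rw [coeff_prod_erase, Matrix.vandermonde_apply, mul_comm, Matrix.mul_apply]
    congr 1
    have hk : (k : ℕ) + 1 ≤ N := k.2
    simp only [L, Matrix.of_apply, Matrix.transpose_apply, Matrix.vandermonde_apply, ite_mul,
      zero_mul]
    rw [Fin.sum_univ_eq_sum_range (fun i => if i ≤ (k : ℕ) then q (k - i) * y j ^ i else 0),
      ← Finset.sum_filter]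
    refine Finset.sum_congr ?_ fun i _ => rfl
    ext i
    simp only [Finset.mem_filter, Finset.mem_range]
    omega
  have h3 := congrArg Matrix.det h1
  rw [Matrix.det_mul_column, Matrix.det_mul, Matrix.det_mul, hL, mul_one,
    Matrix.det_transpose] at h3
  rw [← h3, mul_comm]

end CauchyDet

/-! ### Expansion over partitions -/

section Expansion

variable {R : Type*} [CommRing R] {N : ℕ}

/-- The alternant `det [x_j ^ κ_i]`. -/
def altDet (x : Fin N → R) (κ : Fin N → ℕ) : R :=
  (Matrix.of fun i j => x j ^ κ i).det

theorem altDet_comp_perm (x : Fin N → R) (κ : Fin N → ℕ) (σ : Equiv.Perm (Fin N)) :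
    altDet x (κ ∘ σ) = (Equiv.Perm.sign σ : ℤ) * altDet x κ := by
  rw [altDet, altDet, ← Matrix.det_permute]
  rfl

theorem altDet_eq_zero (x : Fin N → R) {κ : Fin N → ℕ} (h : ¬ Function.Injective κ) :
    altDet x κ = 0 := by
  simp only [Function.Injective, not_forall] at h
  obtain ⟨i, j, hij, hne⟩ := h
  refine Matrix.det_zero_of_row_eq hne ?_
  funext l
  simp [hij]

theorem altDet_eq_sum (x : Fin N → R) (κ : Fin N → ℕ) :
    altDet x κ = ∑ σ : Equiv.Perm (Fin N), (Equiv.Perm.sign σ : ℤ) * ∏ i, x i ^ κ (σ i) := by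
  rw [altDet, Matrix.det_apply']
  rfl

/-- The strictly decreasing exponents attached to a partition. -/
def shifted (ν : Fin N → ℕ) (i : Fin N) : ℕ := N - 1 - i + ν i

theorem strictAnti_shifted {ν : Fin N → ℕ} (hν : Antitone ν) : StrictAnti (shifted ν) := by
  intro i j hij
  have := hν hij.le
  have h2 : (i : ℕ) < j := hij
  have := j.2
  simp only [shifted]
  omega

theorem add_le_of_strictAnti {f : Fin N → ℕ} (hf : StrictAnti f) (d : ℕ) (i j : Fin N)
    (h : (j : ℕ) = i + d) : f j + d ≤ f i := by
  induction d generalizing j with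
  | zero =>
    have : j = i := Fin.ext h
    rw [this, add_zero]
  | succ d ih =>
    have hj := j.2
    have h1 := ih ⟨i + d, by omega⟩ rfl
    have h2 : (⟨i + d, by omega⟩ : Fin N) < j := by
      rw [Fin.lt_def]; simp only; omega
    have := hf h2
    omega

theorem exists_shifted {f : Fin N → ℕ} (hf : StrictAnti f) :
    ∃ ν : Fin N → ℕ, Antitone ν ∧ shifted ν = f := by
  have h0 : ∀ i, N - 1 - i ≤ f i := by
    intro i
    have hi := i.2
    have := add_le_of_strictAnti hf (N - 1 - i) i ⟨N - 1, by omega⟩ (by simp only; omega)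
    omega
  refine ⟨fun i => f i - (N - 1 - i), fun i j hij => ?_, ?_⟩
  · have h1 := add_le_of_strictAnti hf (j - i) i j (by have : (i : ℕ) ≤ j := hij; omega)
    have := h0 i
    have := h0 j
    have : (i : ℕ) ≤ j := hij
    have := j.2
    simp only
    omega
  · funext i
    have := h0 i
    simp only [shifted]
    omega

theorem sum_shifted (ν : Fin N → ℕ) : ∑ i, shifted ν i = ∑ i : Fin N, (i : ℕ) + ∑ i, ν i := by
  simp only [shifted, Finset.sum_add_distrib]
  congr 1
  refine Fintype.sum_equiv Fin.revPerm _ _ fun i => ?_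
  rw [Fin.revPerm_apply, Fin.val_rev]
  omega

/-- The partitions of `d` with at most `N` parts. -/
noncomputable def youngFinset (N d : ℕ) : Finset (Fin N → ℕ) :=
  let _ := Classical.decPred (Antitone : (Fin N → ℕ) → Prop)
  (Finset.piAntidiag Finset.univ d).filter Antitone

theorem mem_youngFinset {d : ℕ} {ν : Fin N → ℕ} :
    ν ∈ youngFinset N d ↔ ∑ i, ν i = d ∧ Antitone ν := by
  simp [youngFinset, Finset.mem_piAntidiag]

/-- Exponents with a repetition contribute zero, and every injective exponent vector is a
permutation of `shifted ν` for a unique partition and a unique permutation. Summing over the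
permutations rebuilds the alternant in `y`. -/
theorem sum_piAntidiag_eq (x y : Fin N → R) (d : ℕ) :
    ∑ κ ∈ Finset.piAntidiag (Finset.univ : Finset (Fin N)) (∑ i : Fin N, (i : ℕ) + d),
      (∏ i, y i ^ κ i) * altDet x κ =
    ∑ ν ∈ youngFinset N d, altDet x (shifted ν) * altDet y (shifted ν) := by
  classical
  have h1 : ∑ κ ∈ Finset.piAntidiag (Finset.univ : Finset (Fin N)) (∑ i : Fin N, (i : ℕ) + d),
      (∏ i, y i ^ κ i) * altDet x κ =
      ∑ κ ∈ (Finset.piAntidiag (Finset.univ : Finset (Fin N))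
        (∑ i : Fin N, (i : ℕ) + d)).filter Function.Injective, (∏ i, y i ^ κ i) * altDet x κ := by
    symm
    refine Finset.sum_filter_of_ne fun κ _ h => ?_
    by_contra h'
    exact h (by rw [altDet_eq_zero x h', mul_zero])
  have h2 : ∑ ν ∈ youngFinset N d, altDet x (shifted ν) * altDet y (shifted ν) =
      ∑ p ∈ youngFinset N d ×ˢ (Finset.univ : Finset (Equiv.Perm (Fin N))),
        (∏ i, y i ^ (shifted p.1 ∘ p.2) i) * altDet x (shifted p.1 ∘ p.2) := by
    rw [Finset.sum_product]
    refine Finset.sum_congr rfl fun ν _ => ?_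
    rw [altDet_eq_sum y, Finset.mul_sum]
    refine Finset.sum_congr rfl fun σ _ => ?_
    rw [altDet_comp_perm]
    simp only [Function.comp]
    ring
  rw [h1, h2]
  symm
  refine Finset.sum_bij (fun p _ => shifted p.1 ∘ p.2) ?_ ?_ ?_ fun _ _ => rfl
  · rintro ⟨ν, σ⟩ hp
    have hν := mem_youngFinset.1 (Finset.mem_product.1 hp).1
    rw [Finset.mem_filter, Finset.mem_piAntidiag]
    refine ⟨⟨?_, by simp⟩, (strictAnti_shifted hν.2).injective.comp σ.injective⟩
    simp only [Function.comp]
    rw [Equiv.sum_comp σ (shifted ν), sum_shifted, hν.1]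
  · rintro ⟨ν, σ⟩ hp ⟨μ, τ⟩ hq h
    have hν := mem_youngFinset.1 (Finset.mem_product.1 hp).1
    have hμ := mem_youngFinset.1 (Finset.mem_product.1 hq).1
    simp only at h
    have hr : Set.range (shifted ν) = Set.range (shifted μ) := by
      rw [← σ.surjective.range_comp, h, τ.surjective.range_comp]
    have h3 : shifted ν = shifted μ := by
      have := (StrictMono.range_inj
        (f := shifted ν ∘ Fin.rev) (g := shifted μ ∘ Fin.rev)
        ((strictAnti_shifted hν.2).comp Fin.rev_strictAnti)
        ((strictAnti_shifted hμ.2).comp Fin.rev_strictAnti)).1 (by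
          rw [Fin.rev_surjective.range_comp, Fin.rev_surjective.range_comp, hr])
      funext i
      simpa using congrFun this (Fin.rev i)
    have h4 : ν = μ := by
      funext i
      have := congrFun h3 i
      simp only [shifted] at this
      omega
    subst h4
    have h5 : σ = τ := Equiv.ext fun i => (strictAnti_shifted hν.2).injective (congrFun h i)
    rw [h5]
  · intro κ hκ
    rw [Finset.mem_filter, Finset.mem_piAntidiag] at hκ
    obtain ⟨⟨hsum, -⟩, hinj⟩ := hκ
    -- Sorts `κ` into decreasing order; its inverse is the required permutation.
    set τ : Equiv.Perm (Fin N) := (Fin.revPerm : Equiv.Perm (Fin N)).trans (Tuple.sort κ)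
    have hanti : StrictAnti (κ ∘ τ) := by
      have h3 : StrictMono (κ ∘ Tuple.sort κ) :=
        (Tuple.monotone_sort κ).strictMono_of_injective (hinj.comp (Tuple.sort κ).injective)
      exact h3.comp_strictAnti Fin.rev_strictAnti
    obtain ⟨ν, hν, hνκ⟩ := exists_shifted hanti
    refine ⟨(ν, τ⁻¹), ?_, ?_⟩
    · rw [Finset.mem_product, mem_youngFinset]
      refine ⟨⟨?_, hν⟩, Finset.mem_univ _⟩
      have h4 := sum_shifted ν
      rw [hνκ, show ∑ i, (κ ∘ τ) i = ∑ i, κ i from Equiv.sum_comp τ κ, hsum] at h4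
      simp only
      omega
    · simp only [hνκ]
      funext i
      simp

/-- The geometric series `1 / (1 - a t)`. -/
def geomSeries (a : R) : PowerSeries R := PowerSeries.mk fun k => a ^ k

theorem geomSeries_mul (a : R) : geomSeries a * (1 - PowerSeries.X * PowerSeries.C a) = 1 := by
  ext n
  rw [mul_sub, mul_one, ← mul_assoc, map_sub, PowerSeries.coeff_mul_C]
  cases n with
  | zero => simp [geomSeries]
  | succ n =>
    rw [PowerSeries.coeff_succ_mul_X]
    simp [geomSeries, pow_succ]

/-- The complete symmetric function of the products `x_i y_j`. -/
noncomputable def cauchyCoeff (x y : Fin N → R) (d : ℕ) : R :=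
  PowerSeries.coeff d (∏ i, ∏ j, geomSeries (x i * y j))

theorem coeff_det_geomSeries (x y : Fin N → R) (d : ℕ) :
    PowerSeries.coeff d (Matrix.of fun i j => geomSeries (x i * y j)).det =
      ∑ κ ∈ Finset.piAntidiag (Finset.univ : Finset (Fin N)) d,
        (∏ i, y i ^ κ i) * altDet x κ := by
  classical
  have h : ∀ κ : Fin N → ℕ, altDet x κ =
      ∑ σ : Equiv.Perm (Fin N), Equiv.Perm.sign σ • ∏ i, x (σ i) ^ κ i := by
    intro κ
    rw [altDet, ← Matrix.det_transpose, Matrix.det_apply]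
    rfl
  have h2 : ∀ σ : Equiv.Perm (Fin N), PowerSeries.coeff d (∏ i, geomSeries (x (σ i) * y i)) =
      ∑ κ ∈ Finset.piAntidiag (Finset.univ : Finset (Fin N)) d,
        (∏ i, y i ^ κ i) * ∏ i, x (σ i) ^ κ i := by
    intro σ
    rw [PowerSeries.coeff_prod]
    refine Finset.sum_bij (fun l _ => (l : Fin N → ℕ)) ?_ ?_ ?_ ?_
    · intro l hl
      rw [Finset.mem_finsuppAntidiag] at hl
      exact Finset.mem_piAntidiag.2 ⟨hl.1, by simp⟩
    · intro l _ l' _ hll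
      exact DFunLike.coe_injective hll
    · intro κ hκ
      rw [Finset.mem_piAntidiag] at hκ
      exact ⟨Finsupp.equivFunOnFinite.symm κ,
        Finset.mem_finsuppAntidiag.2 ⟨by simpa using hκ.1, by simp⟩, by simp⟩
    · intro l _
      rw [← Finset.prod_mul_distrib]
      exact Finset.prod_congr rfl fun i _ => by
        rw [geomSeries, PowerSeries.coeff_mk, mul_pow, mul_comm]
  rw [Matrix.det_apply, map_sum]
  simp only [h, Finset.mul_sum]
  rw [Finset.sum_comm]
  refine Finset.sum_congr rfl fun σ _ => ?_
  rw [Units.smul_def, map_zsmul]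
  simp only [Matrix.of_apply]
  rw [h2, Finset.smul_sum]
  exact Finset.sum_congr rfl fun κ _ => by rw [Units.smul_def, mul_smul_comm]

theorem altDet_shifted_zero (x : Fin N → R) : altDet x (shifted 0) =
    (Equiv.Perm.sign (Fin.revPerm : Equiv.Perm (Fin N)) : ℤ) * (Matrix.vandermonde x).det := by
  have h : shifted (0 : Fin N → ℕ) = (fun i : Fin N => (i : ℕ)) ∘ (Fin.revPerm : Equiv.Perm (Fin N)) := by
    funext i
    simp only [shifted, Pi.zero_apply, Function.comp, Fin.revPerm_apply, Fin.val_rev]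
    omega
  rw [h, altDet_comp_perm, altDet, ← Matrix.det_transpose]
  rfl

/-- Both sides are the coefficient of `t ^ (d + N (N - 1) / 2)` in `det [1 / (1 - x_i y_j t)]`,
computed by expanding the determinant and by the Cauchy determinant. The extra exponent is the
degree of the Vandermonde determinant in the `x_i t`. -/
theorem sum_altDet_mul_altDet (x y : Fin N → R) (d : ℕ) :
    ∑ ν ∈ youngFinset N d, altDet x (shifted ν) * altDet y (shifted ν) =
      altDet x (shifted 0) * altDet y (shifted 0) * cauchyCoeff x y d := by
  have hgeom : ∀ i j, geomSeries (x i * y j) *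
      (1 - (PowerSeries.X * PowerSeries.C (x i)) * PowerSeries.C (y j)) = 1 := fun i j => by
    rw [mul_assoc, ← map_mul, geomSeries_mul]
  have h1 := det_cauchy (fun i => PowerSeries.X * PowerSeries.C (x i))
    (fun j => PowerSeries.C (y j)) (Matrix.of fun i j => geomSeries (x i * y j)) hgeom
  have hC : ∀ z : Fin N → R, (Matrix.vandermonde fun j => PowerSeries.C (z j)).det =
      PowerSeries.C (Matrix.vandermonde z).det := by
    intro z
    rw [RingHom.map_det]
    congr 1
    ext i j : 2
    simp [Matrix.vandermonde_apply]
  have hX : (Matrix.vandermonde fun i => PowerSeries.X * PowerSeries.C (x i)).det =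
      PowerSeries.X ^ (∑ i : Fin N, (i : ℕ)) * PowerSeries.C (Matrix.vandermonde x).det := by
    rw [← hC, ← Finset.prod_pow_eq_pow_sum, ← Matrix.det_mul_row]
    congr 1
    ext i j : 2
    simp [Matrix.vandermonde_apply, mul_pow]
  have h2 : (∏ i, ∏ j, geomSeries (x i * y j)) * ∏ i, ∏ j,
      (1 - (PowerSeries.X * PowerSeries.C (x i)) * PowerSeries.C (y j)) = 1 := by
    simp only [← Finset.prod_mul_distrib, hgeom, Finset.prod_const_one]
  have h3 : (Matrix.of fun i j => geomSeries (x i * y j)).det =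
      PowerSeries.X ^ (∑ i : Fin N, (i : ℕ)) * (PowerSeries.C ((Matrix.vandermonde x).det *
        (Matrix.vandermonde y).det) * ∏ i, ∏ j, geomSeries (x i * y j)) := by
    rw [hX, hC] at h1
    rw [map_mul]
    linear_combination (∏ i, ∏ j, geomSeries (x i * y j)) * h1 -
      (Matrix.of fun i j => geomSeries (x i * y j)).det * h2
  have hs : ((Equiv.Perm.sign (Fin.revPerm : Equiv.Perm (Fin N)) : ℤ) : R) *
      ((Equiv.Perm.sign (Fin.revPerm : Equiv.Perm (Fin N)) : ℤ) : R) = 1 := by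
    rw [← Int.cast_mul, ← Units.val_mul, Int.units_mul_self]
    simp
  rw [← sum_piAntidiag_eq, ← coeff_det_geomSeries, h3, add_comm, PowerSeries.coeff_X_pow_mul,
    PowerSeries.coeff_C_mul, altDet_shifted_zero, altDet_shifted_zero, cauchyCoeff]
  linear_combination (-(Matrix.vandermonde x).det * (Matrix.vandermonde y).det *
    PowerSeries.coeff d (∏ i, ∏ j, geomSeries (x i * y j))) * hs

end Expansion
end CUESchur

namespace CUESchur

/-! ### The Cauchy identity for Schur polynomials -/

variable {N : ℕ}

theorem aeval_alternant {B : Type*} [CommRing B] [Algebra ℂ B] (x : Fin N → B) (ν : Fin N → ℕ) :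
    MvPolynomial.aeval x (alternant N ν) = altDet x (shifted ν) := by
  rw [alternant, altDet, AlgHom.map_det]
  congr 1
  ext i j
  simp [shifted]

theorem map_cauchyCoeff {R S : Type*} [CommRing R] [CommRing S] (f : R →+* S) (x y : Fin N → R)
    (d : ℕ) : f (cauchyCoeff x y d) = cauchyCoeff (fun i => f (x i)) (fun i => f (y i)) d := by
  have h : ∀ a, PowerSeries.map f (geomSeries a) = geomSeries (f a) := by
    intro a
    ext n
    simp [geomSeries]
  rw [cauchyCoeff, cauchyCoeff, ← PowerSeries.coeff_map, map_prod]
  simp only [map_prod, h, map_mul]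

/-- The alternants may vanish at `u` or `v` when entries repeat, so the division is carried out in a
polynomial ring in `2 N` independent variables and the result is then specialized. -/
theorem sum_schurPoly_mul_schurPoly (u v : Fin N → ℂ) (d : ℕ) :
    ∑ ν ∈ youngFinset N d, MvPolynomial.eval u (schurPoly N ν) *
      MvPolynomial.eval v (schurPoly N ν) = cauchyCoeff u v d := by
  set x : Fin N → MvPolynomial (Fin N ⊕ Fin N) ℂ := fun i => MvPolynomial.X (Sum.inl i)
  set y : Fin N → MvPolynomial (Fin N ⊕ Fin N) ℂ := fun i => MvPolynomial.X (Sum.inr i)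
  have hne : ∀ f : Fin N → Fin N ⊕ Fin N, Function.Injective f →
      altDet (fun i => (MvPolynomial.X (f i) : MvPolynomial (Fin N ⊕ Fin N) ℂ))
        (shifted 0) ≠ 0 := by
    intro f hf
    have h : (MvPolynomial.aeval fun i => MvPolynomial.X (f i) :
        MvPolynomial (Fin N) ℂ →ₐ[ℂ] MvPolynomial (Fin N ⊕ Fin N) ℂ) = MvPolynomial.rename f := by
      ext i
      simp
    rw [← aeval_alternant, h]
    have := (MvPolynomial.rename_injective f hf).ne (alternant_zero_ne_zero N)
    rw [map_zero] at this
    exact this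
  have hfac : ∀ (z : Fin N → MvPolynomial (Fin N ⊕ Fin N) ℂ) (ν : Fin N → ℕ),
      altDet z (shifted ν) = altDet z (shifted 0) * MvPolynomial.aeval z (schurPoly N ν) := by
    intro z ν
    rw [← aeval_alternant, ← aeval_alternant, ← map_mul, ← alternant_eq]
  have h1 : ∑ ν ∈ youngFinset N d, MvPolynomial.aeval x (schurPoly N ν) *
      MvPolynomial.aeval y (schurPoly N ν) = cauchyCoeff x y d := by
    have h2 := sum_altDet_mul_altDet x y d
    refine mul_left_cancel₀ (mul_ne_zero (hne _ Sum.inl_injective) (hne _ Sum.inr_injective))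
      (Eq.trans ?_ h2)
    rw [Finset.mul_sum]
    refine Finset.sum_congr rfl fun ν _ => ?_
    rw [hfac x ν, hfac y ν]
    ring
  have h3 := congrArg (MvPolynomial.aeval (Sum.elim u v) :
    MvPolynomial (Fin N ⊕ Fin N) ℂ →ₐ[ℂ] ℂ) h1
  have hx : ∀ p : MvPolynomial (Fin N) ℂ,
      MvPolynomial.aeval (Sum.elim u v) (MvPolynomial.aeval x p) = MvPolynomial.eval u p := by
    intro p
    have h : (MvPolynomial.aeval (Sum.elim u v)).comp (MvPolynomial.aeval x) =
        (MvPolynomial.aeval u : MvPolynomial (Fin N) ℂ →ₐ[ℂ] ℂ) := by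
      ext i
      simp [x]
    rw [← AlgHom.comp_apply, h, MvPolynomial.aeval_eq_eval]
  have hy : ∀ p : MvPolynomial (Fin N) ℂ,
      MvPolynomial.aeval (Sum.elim u v) (MvPolynomial.aeval y p) = MvPolynomial.eval v p := by
    intro p
    have h : (MvPolynomial.aeval (Sum.elim u v)).comp (MvPolynomial.aeval y) =
        (MvPolynomial.aeval v : MvPolynomial (Fin N) ℂ →ₐ[ℂ] ℂ) := by
      ext i
      simp [y]
    rw [← AlgHom.comp_apply, h, MvPolynomial.aeval_eq_eval]
  simp only [map_sum, map_mul, hx, hy] at h3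
  rw [h3]
  have h4 := map_cauchyCoeff (MvPolynomial.aeval (Sum.elim u v) :
    MvPolynomial (Fin N ⊕ Fin N) ℂ →ₐ[ℂ] ℂ).toRingHom x y d
  refine h4.trans ?_
  simp [x, y]

/-- The alternants are fixed by conjugation of coefficients, and so is their quotient, by
cancellation. -/
theorem eval_star_schurPoly (u : Fin N → ℂ) (ν : Fin N → ℕ) :
    MvPolynomial.eval (fun i => star (u i)) (schurPoly N ν) =
      star (MvPolynomial.eval u (schurPoly N ν)) := by
  have h1 : ∀ μ, MvPolynomial.map (starRingEnd ℂ) (alternant N μ) = alternant N μ := by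
    intro μ
    rw [alternant, RingHom.map_det]
    congr 1
    ext1 i j
    simp
  have h2 : MvPolynomial.map (starRingEnd ℂ) (schurPoly N ν) = schurPoly N ν := by
    have h3 := congrArg (MvPolynomial.map (starRingEnd ℂ)) (alternant_eq N ν)
    rw [map_mul, h1, h1, alternant_eq] at h3
    exact (mul_left_cancel₀ (alternant_zero_ne_zero N) h3).symm
  conv_lhs => rw [← h2]
  rw [MvPolynomial.eval_map]
  exact (MvPolynomial.eval₂_comp (starRingEnd ℂ) u _).symm

theorem sum_norm_schurChar_sq (V : Matrix (Fin N) (Fin N) ℂ) (d : ℕ) :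
    ((∑ ν ∈ youngFinset N d, ‖schurChar ν V‖ ^ 2 : ℝ) : ℂ) =
      cauchyCoeff (eigenvalues V) (fun i => star (eigenvalues V i)) d := by
  rw [← sum_schurPoly_mul_schurPoly, Complex.ofReal_sum]
  refine Finset.sum_congr rfl fun ν _ => ?_
  rw [eval_star_schurPoly, schurChar, Complex.ofReal_pow, ← Complex.mul_conj']
  rfl

theorem hasSum_coeff_prod {ι : Type*} (s : Finset ι) (f : ι → PowerSeries ℂ) (F : ι → ℂ) (q : ℂ)
    (hs : ∀ i ∈ s, Summable fun d => ‖PowerSeries.coeff d (f i) * q ^ d‖)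
    (hf : ∀ i ∈ s, HasSum (fun d => PowerSeries.coeff d (f i) * q ^ d) (F i)) :
    (Summable fun d => ‖PowerSeries.coeff d (∏ i ∈ s, f i) * q ^ d‖) ∧
      HasSum (fun d => PowerSeries.coeff d (∏ i ∈ s, f i) * q ^ d) (∏ i ∈ s, F i) := by
  classical
  induction s using Finset.induction_on with
  | empty =>
    have h : ∀ d, d ≠ 0 → PowerSeries.coeff d (1 : PowerSeries ℂ) * q ^ d = 0 := by
      intro d hd
      simp [PowerSeries.coeff_one, hd]
    refine ⟨summable_of_ne_finset_zero (s := {0}) fun d hd => ?_, ?_⟩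
    · rw [Finset.prod_empty, h d (by simpa using hd), norm_zero]
    · simpa using hasSum_single 0 h
  | insert a s ha ih =>
    obtain ⟨ih1, ih2⟩ := ih (fun i hi => hs i (Finset.mem_insert_of_mem hi))
      (fun i hi => hf i (Finset.mem_insert_of_mem hi))
    have hs' := hs a (Finset.mem_insert_self a s)
    have hf' := hf a (Finset.mem_insert_self a s)
    have hcoeff : ∀ d, PowerSeries.coeff d (f a * ∏ i ∈ s, f i) * q ^ d =
        ∑ p ∈ Finset.HasAntidiagonal.antidiagonal d, (PowerSeries.coeff p.1 (f a) * q ^ p.1) *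
          (PowerSeries.coeff p.2 (∏ i ∈ s, f i) * q ^ p.2) := by
      intro d
      rw [PowerSeries.coeff_mul, Finset.sum_mul]
      refine Finset.sum_congr rfl fun p hp => ?_
      rw [← Finset.HasAntidiagonal.mem_antidiagonal.1 hp, pow_add]
      ring
    rw [Finset.prod_insert ha, Finset.prod_insert ha]
    have hsum := summable_norm_sum_mul_antidiagonal_of_summable_norm hs' ih1
    simp only [hcoeff]
    refine ⟨hsum, ?_⟩
    rw [← hf'.tsum_eq, ← ih2.tsum_eq,
      tsum_mul_tsum_eq_tsum_sum_antidiagonal_of_summable_norm hs' ih1]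
    exact hsum.of_norm.hasSum

theorem hasSum_cauchyCoeff (x y : Fin N → ℂ) (q : ℂ) (h : ∀ i j, ‖x i * y j * q‖ < 1) :
    HasSum (fun d => cauchyCoeff x y d * q ^ d) (∏ i, ∏ j, (1 - x i * y j * q)⁻¹) := by
  have h1 : ∀ i j, (Summable fun d => ‖PowerSeries.coeff d (geomSeries (x i * y j)) * q ^ d‖) ∧
      HasSum (fun d => PowerSeries.coeff d (geomSeries (x i * y j)) * q ^ d)
        (1 - x i * y j * q)⁻¹ := by
    intro i j
    simp only [geomSeries, PowerSeries.coeff_mk, ← mul_pow]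
    exact ⟨by simpa using summable_geometric_of_lt_one (norm_nonneg _) (h i j),
      hasSum_geometric_of_norm_lt_one (h i j)⟩
  have h2 := fun i => hasSum_coeff_prod Finset.univ _ _ q (fun j _ => (h1 i j).1)
    (fun j _ => (h1 i j).2)
  exact (hasSum_coeff_prod Finset.univ _ _ q (fun i _ => (h2 i).1) (fun i _ => (h2 i).2)).2

/-- The partition function as a product over pairs of eigenvalues. -/
theorem hasSum_partitionFunction (U : Matrix.unitaryGroup (Fin N) ℂ) {q : ℝ} (hq0 : 0 ≤ q)
    (hq1 : q < 1) {Z : ℝ}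
    (hZ : (Z : ℂ) = ∏ i, ∏ j, (1 - eigenvalues U.1 i * star (eigenvalues U.1 j) * q)⁻¹) :
    HasSum (fun ν : YoungVec N => q ^ (∑ i, ν.1 i) * ‖schurChar ν.1 U.1‖ ^ 2) Z := by
  have h1 : HasSum (fun d : ℕ => q ^ d * ∑ ν ∈ youngFinset N d, ‖schurChar ν U.1‖ ^ 2) Z := by
    rw [← Complex.hasSum_ofReal, hZ]
    have := hasSum_cauchyCoeff (eigenvalues U.1) (fun j => star (eigenvalues U.1 j)) (q : ℂ) (by
      intro i j
      rw [norm_mul, norm_mul, norm_star, norm_eigenvalues, norm_eigenvalues]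
      simpa [abs_of_nonneg hq0] using hq1)
    convert this using 2 with d
    rw [← sum_norm_schurChar_sq]
    push_cast
    ring
  let deg : YoungVec N → ℕ := fun ν => ∑ i, ν.1 i
  let f : (Σ d, {ν : YoungVec N // deg ν = d}) → ℝ :=
    fun p => q ^ p.1 * ‖schurChar p.2.1.1 U.1‖ ^ 2
  have hf0 : ∀ p, 0 ≤ f p := fun p => by positivity
  have hfib : ∀ d, HasSum (fun ν => f ⟨d, ν⟩)
      (q ^ d * ∑ ν ∈ youngFinset N d, ‖schurChar ν U.1‖ ^ 2) := by
    intro d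
    let e : {ν : YoungVec N // deg ν = d} ≃ {ν // ν ∈ youngFinset N d} :=
      { toFun := fun ν => ⟨ν.1.1, mem_youngFinset.2 ⟨ν.2, ν.1.2⟩⟩
        invFun := fun ν => ⟨⟨ν.1, (mem_youngFinset.1 ν.2).2⟩, (mem_youngFinset.1 ν.2).1⟩
        left_inv := fun _ => rfl
        right_inv := fun _ => rfl }
    have h2 := (Finset.hasSum (youngFinset N d) fun ν => ‖schurChar ν U.1‖ ^ 2).mul_left (q ^ d)
    exact e.hasSum_iff.2 h2
  -- Nonnegativity turns convergence of the sum grouped by degree into summability over all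
  -- partitions.
  have hsum : Summable f := (summable_sigma_of_nonneg hf0).2
    ⟨fun d => (hfib d).summable, by simpa only [(hfib _).tsum_eq] using h1.summable⟩
  have h3 : HasSum f Z := by
    rw [h1.unique (hsum.hasSum.sigma hfib)]
    exact hsum.hasSum
  rw [← (Equiv.sigmaFiberEquiv deg).hasSum_iff]
  convert h3 using 1
  funext p
  obtain ⟨d, ν, rfl⟩ := p
  rfl

/-- The logarithm of the partition function in terms of power traces. -/
theorem hasSum_log_partitionFunction (U : Matrix.unitaryGroup (Fin N) ℂ) {q : ℝ} (hq0 : 0 ≤ q)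
    (hq1 : q < 1) :
    HasSum (fun m : ℕ => q ^ m / m * sqTrace m U) (Real.log (partitionFunction q U.1)) := by
  set z : Fin N → Fin N → ℂ :=
    fun i j => eigenvalues U.1 i * star (eigenvalues U.1 j) * q with hz
  have hz1 : ∀ i j, ‖z i j‖ < 1 := by
    intro i j
    rw [hz, norm_mul, norm_mul, norm_star, norm_eigenvalues, norm_eigenvalues]
    simpa [abs_of_nonneg hq0] using hq1
  -- The `m = 0` term is a division by zero and hence `0`, so the series may run over all natural
  -- numbers.
  have h1 : HasSum (fun m : ℕ => ∑ i, ∑ j, z i j ^ m / m)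
      (∑ i, ∑ j, -Complex.log (1 - z i j)) :=
    hasSum_sum fun i _ => hasSum_sum fun j _ => Complex.hasSum_taylorSeries_neg_log (hz1 i j)
  have h2 : (fun m : ℕ => ∑ i, ∑ j, z i j ^ m / m) =
      fun m : ℕ => ((q ^ m / m * sqTrace m U : ℝ) : ℂ) := by
    funext m
    have h3 : (sqTrace m U : ℂ) =
        (∑ i, eigenvalues U.1 i ^ m) * ∑ j, star (eigenvalues U.1 j) ^ m := by
      rw [sqTrace_eq, powTrace_neg, powTrace_eq_sum, star_sum, mul_comm]
      simp only [zpow_natCast, star_pow]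
    rw [Complex.ofReal_mul, h3, Finset.sum_mul_sum, Finset.mul_sum]
    refine Finset.sum_congr rfl fun i _ => ?_
    rw [Finset.mul_sum]
    refine Finset.sum_congr rfl fun j _ => ?_
    simp only [hz, mul_pow]
    push_cast
    ring
  rw [h2] at h1
  obtain ⟨S, hS⟩ : Summable fun m : ℕ => q ^ m / m * sqTrace m U :=
    Complex.summable_ofReal.1 h1.summable
  have h4 := h1.unique (Complex.hasSum_ofReal.2 hS)
  -- Exponentiating removes any question of branches: the sum of complex logarithms equals the real
  -- `S`, and its exponential is the product.
  have h5 : ((Real.exp S : ℝ) : ℂ) = ∏ i, ∏ j, (1 - z i j)⁻¹ := by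
    rw [Complex.ofReal_exp, ← h4, Complex.exp_sum]
    refine Finset.prod_congr rfl fun i _ => ?_
    rw [Complex.exp_sum]
    refine Finset.prod_congr rfl fun j _ => ?_
    rw [Complex.exp_neg, Complex.exp_log]
    intro h
    have := hz1 i j
    rw [← sub_eq_zero.1 h, norm_one] at this
    exact lt_irrefl _ this
  rw [partitionFunction, (hasSum_partitionFunction U hq0 hq1 h5).tsum_eq, Real.log_exp]
  exact hS

end CUESchur

namespace CUESchur

/-! ### Mean and variance of the free energy -/

variable {N : ℕ}

theorem hasSum_pow_div {q : ℝ} (hq0 : 0 ≤ q) (hq1 : q < 1) :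
    HasSum (fun m : ℕ => q ^ m / m) (-Real.log (1 - q)) := by
  have h := Real.hasSum_pow_div_log_of_abs_lt_one (x := q) (by rwa [abs_of_nonneg hq0])
  rw [← hasSum_nat_add_iff' 1]
  simpa using h

theorem summable_pow_div_mul {q : ℝ} (hq0 : 0 ≤ q) (hq1 : q < 1) (C : ℝ) :
    Summable fun m : ℕ => q ^ m / m * C :=
  (hasSum_pow_div hq0 hq1).summable.mul_right C

theorem norm_pow_div_mul_sqTrace_le {q : ℝ} (hq0 : 0 ≤ q) (m : ℕ)
    (U : Matrix.unitaryGroup (Fin N) ℂ) :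
    ‖q ^ m / m * sqTrace m U‖ ≤ q ^ m / m * (N : ℝ) ^ 2 := by
  have h : 0 ≤ q ^ m / m := by positivity
  rw [Real.norm_of_nonneg (mul_nonneg h (sqTrace_nonneg m U))]
  exact mul_le_mul_of_nonneg_left (sqTrace_le m U) h

theorem continuous_log_partitionFunction {q : ℝ} (hq0 : 0 ≤ q) (hq1 : q < 1) :
    Continuous fun U : Matrix.unitaryGroup (Fin N) ℂ => Real.log (partitionFunction q U.1) := by
  have h : (fun U : Matrix.unitaryGroup (Fin N) ℂ => Real.log (partitionFunction q U.1)) =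
      fun U => ∑' m : ℕ, q ^ m / m * sqTrace m U :=
    funext fun U => (hasSum_log_partitionFunction U hq0 hq1).tsum_eq.symm
  rw [h]
  exact continuous_tsum (fun m => continuous_const.mul (continuous_sqTrace m))
    (summable_pow_div_mul hq0 hq1 _) fun m U => norm_pow_div_mul_sqTrace_le hq0 m U

theorem sum_sum_pow_div_le {q : ℝ} (hq0 : 0 ≤ q) (hq1 : q < 1) (M : ℕ) :
    ∑ m ∈ Finset.range M, ∑ n ∈ Finset.range M, q ^ m / m * (q ^ n / n) *
      (2 * (min m n : ℕ) + if m = n then (m : ℝ) ^ 2 else 0) ≤ 5 / (1 - q) := by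
  -- For `m ≤ n` the factor `min m n = m` cancels `1 / m`, leaving at most `q ^ n / n`. Summation
  -- over the at most `n` values of `m` gives `q ^ n`, then a geometric series. The two orders of
  -- `m` and `n` cost `2` each and the diagonal costs `1`, hence the `5`.
  set g : ℕ → ℕ → ℝ := fun m n => if 1 ≤ m ∧ m ≤ n then q ^ n / n else 0 with hg
  have hpow : ∀ k, q ^ k ≤ 1 := fun k => pow_le_one₀ hq0 hq1.le
  have hg0 : ∀ m n, 0 ≤ g m n := fun m n => by
    simp only [hg]
    split_ifs <;> positivity
  have hmin : ∀ m n : ℕ, 1 ≤ m → m ≤ n → q ^ m / m * (q ^ n / n) * m ≤ g m n := by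
    intro m n hm hmn
    have hm' : (m : ℝ) ≠ 0 := by positivity
    have h1 : q ^ m / m * (q ^ n / n) * m = q ^ m * (q ^ n / n) := by field_simp
    rw [h1, hg]
    simp only [hm, hmn, and_self, if_true]
    exact mul_le_of_le_one_left (by positivity) (hpow m)
  have hterm : ∀ m n : ℕ, q ^ m / m * (q ^ n / n) *
      (2 * (min m n : ℕ) + if m = n then (m : ℝ) ^ 2 else 0) ≤
        2 * g m n + 2 * g n m + if m = n then q ^ m else 0 := by
    intro m n
    have hd : q ^ m / m * (q ^ n / n) * (if m = n then (m : ℝ) ^ 2 else 0) ≤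
        if m = n then q ^ m else 0 := by
      split_ifs with h
      · subst h
        rcases Nat.eq_zero_or_pos m with rfl | hm
        · simp
        · have hm' : (m : ℝ) ≠ 0 := by positivity
          have h1 : q ^ m / m * (q ^ m / m) * (m : ℝ) ^ 2 = q ^ m * q ^ m := by field_simp
          rw [h1]
          exact mul_le_of_le_one_left (by positivity) (hpow m)
      · simp
    have hm : q ^ m / m * (q ^ n / n) * (min m n : ℕ) ≤ g m n + g n m := by
      rcases Nat.eq_zero_or_pos m with rfl | hm
      · simpa using add_nonneg (hg0 0 n) (hg0 n 0)
      rcases Nat.eq_zero_or_pos n with rfl | hn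
      · simpa using add_nonneg (hg0 m 0) (hg0 0 m)
      rcases le_total m n with h | h
      · rw [min_eq_left h]
        exact (hmin m n hm h).trans (le_add_of_nonneg_right (hg0 n m))
      · rw [min_eq_right h, mul_comm (q ^ m / m)]
        exact (hmin n m hn h).trans (le_add_of_nonneg_left (hg0 m n))
    rw [mul_add]
    linarith
  have hgeo : ∑ n ∈ Finset.range M, q ^ n ≤ 1 / (1 - q) := by
    rw [one_div, ← tsum_geometric_of_lt_one hq0 hq1]
    exact (summable_geometric_of_lt_one hq0 hq1).sum_le_tsum _ fun n _ => by positivity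
  have hcol : ∀ n, ∑ m ∈ Finset.range M, g m n ≤ q ^ n := by
    intro n
    have hsub : (Finset.range M).filter (fun m => 1 ≤ m ∧ m ≤ n) ⊆ Finset.Icc 1 n := by
      intro m hm
      simpa using (Finset.mem_filter.1 hm).2
    have hcard : (((Finset.range M).filter (fun m => 1 ≤ m ∧ m ≤ n)).card : ℝ) ≤ n := by
      exact_mod_cast (Finset.card_le_card hsub).trans (by simp)
    rw [hg, ← Finset.sum_filter, Finset.sum_const, nsmul_eq_mul]
    refine (mul_le_mul_of_nonneg_right hcard (by positivity)).trans ?_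
    rcases Nat.eq_zero_or_pos n with rfl | hn
    · simp
    · have hn' : (n : ℝ) ≠ 0 := by positivity
      rw [mul_div_cancel₀ _ hn']
  have hG : ∑ m ∈ Finset.range M, ∑ n ∈ Finset.range M, g n m ≤ 1 / (1 - q) :=
    (Finset.sum_le_sum fun m _ => hcol m).trans hgeo
  have hG' : ∑ m ∈ Finset.range M, ∑ n ∈ Finset.range M, g m n ≤ 1 / (1 - q) := by
    rw [Finset.sum_comm]
    exact hG
  have hD : ∑ m ∈ Finset.range M, ∑ n ∈ Finset.range M, (if m = n then q ^ m else 0) ≤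
      1 / (1 - q) := by
    refine (Finset.sum_le_sum fun m hm => ?_).trans hgeo
    rw [Finset.sum_ite_eq, if_pos hm]
  refine (Finset.sum_le_sum fun m _ => Finset.sum_le_sum fun n _ => hterm m n).trans ?_
  simp only [Finset.sum_add_distrib, ← Finset.mul_sum]
  have h5 : 5 / (1 - q) = 5 * (1 / (1 - q)) := by ring
  linarith

theorem memLp_pow_div_mul_sqTrace (q : ℝ) (m : ℕ) :
    MemLp (fun U => q ^ m / m * sqTrace m U) 2 (haarUnitary N) :=
  memLp_of_continuous (continuous_const.mul (continuous_sqTrace m))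

theorem variance_sum_sqTrace_le {q : ℝ} (hq0 : 0 ≤ q) (hq1 : q < 1) (M : ℕ) :
    variance (fun U => ∑ m ∈ Finset.range M, q ^ m / m * sqTrace m U) (haarUnitary N) ≤
      5 / (1 - q) := by
  rw [variance_fun_sum' fun m _ => memLp_pow_div_mul_sqTrace q m]
  refine (Finset.sum_le_sum fun m _ => Finset.sum_le_sum fun n _ => ?_).trans
    (sum_sum_pow_div_le hq0 hq1 M)
  rw [covariance_const_mul_left, covariance_const_mul_right, ← mul_assoc]
  rcases Nat.eq_zero_or_pos m with rfl | hm
  · simp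
  rcases Nat.eq_zero_or_pos n with rfl | hn
  · simp
  exact mul_le_mul_of_nonneg_left (covariance_sqTrace_le hm hn) (by positivity)

/-- The bound for partial sums is uniform, and their first two moments converge by dominated
convergence, each partial sum being at most `K` in absolute value. -/
theorem variance_log_partitionFunction_le {q : ℝ} (hq0 : 0 ≤ q) (hq1 : q < 1) :
    variance (fun U => Real.log (partitionFunction q U.1)) (haarUnitary N) ≤ 5 / (1 - q) := by
  set S : ℕ → Matrix.unitaryGroup (Fin N) ℂ → ℝ :=
    fun M U => ∑ m ∈ Finset.range M, q ^ m / m * sqTrace m U with hS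
  set F : Matrix.unitaryGroup (Fin N) ℂ → ℝ :=
    fun U => Real.log (partitionFunction q U.1) with hF
  set K : ℝ := ∑' m : ℕ, q ^ m / m * (N : ℝ) ^ 2 with hK
  have hSc : ∀ M, Continuous (S M) := fun M =>
    continuous_finsetSum _ fun m _ => continuous_const.mul (continuous_sqTrace m)
  have hFc : Continuous F := continuous_log_partitionFunction hq0 hq1
  have hSK : ∀ M U, ‖S M U‖ ≤ K := fun M U =>
    (norm_sum_le _ _).trans ((Finset.sum_le_sum fun m _ =>
      norm_pow_div_mul_sqTrace_le hq0 m U).trans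
        ((summable_pow_div_mul hq0 hq1 _).sum_le_tsum _ fun m _ => by positivity))
  have hlim : ∀ U, Tendsto (fun M => S M U) atTop (𝓝 (F U)) := fun U =>
    (hasSum_log_partitionFunction U hq0 hq1).tendsto_sum_nat
  have h1 : Tendsto (fun M => ∫ U, S M U ∂(haarUnitary N)) atTop
      (𝓝 (∫ U, F U ∂(haarUnitary N))) :=
    tendsto_integral_of_dominated_convergence (fun _ => K)
      (fun M => (integrable_of_continuous (hSc M)).aestronglyMeasurable) (integrable_const K)
      (fun M => Eventually.of_forall (hSK M)) (Eventually.of_forall hlim)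
  have h2 : Tendsto (fun M => ∫ U, (S M ^ 2) U ∂(haarUnitary N)) atTop
      (𝓝 (∫ U, (F ^ 2) U ∂(haarUnitary N))) :=
    tendsto_integral_of_dominated_convergence (fun _ => K ^ 2)
      (fun M => (integrable_of_continuous ((hSc M).pow 2)).aestronglyMeasurable)
      (integrable_const _)
      (fun M => Eventually.of_forall fun U => by
        rw [Pi.pow_apply, norm_pow]
        exact pow_le_pow_left₀ (norm_nonneg _) (hSK M U) 2)
      (Eventually.of_forall fun U => (hlim U).pow 2)
  have h3 : Tendsto (fun M => variance (S M) (haarUnitary N)) atTop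
      (𝓝 (variance F (haarUnitary N))) := by
    rw [variance_eq_sub (memLp_of_continuous hFc)]
    refine (h2.sub (h1.pow 2)).congr fun M => ?_
    rw [variance_eq_sub (memLp_of_continuous (hSc M))]
  exact le_of_tendsto' h3 fun M => variance_sum_sqTrace_le hq0 hq1 M

theorem integral_log_partitionFunction {q : ℝ} (hq0 : 0 ≤ q) (hq1 : q < 1) :
    ∫ U, Real.log (partitionFunction q U.1) ∂(haarUnitary N) =
      N * (-Real.log (1 - q) - ∑ m ∈ Finset.Icc 1 N, q ^ m / m) +
        ∑ m ∈ Finset.Icc 1 N, q ^ m := by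
  have h1 : HasSum (fun m : ℕ => ∫ U, q ^ m / m * sqTrace m U ∂(haarUnitary N))
      (∫ U, Real.log (partitionFunction q U.1) ∂(haarUnitary N)) :=
    hasSum_integral_of_dominated_convergence (fun m _ => q ^ m / m * (N : ℝ) ^ 2)
      (fun m => (memLp_pow_div_mul_sqTrace q m).aestronglyMeasurable)
      (fun m => Eventually.of_forall fun U => norm_pow_div_mul_sqTrace_le hq0 m U)
      (Eventually.of_forall fun U => summable_pow_div_mul hq0 hq1 _) (integrable_const _)
      (Eventually.of_forall fun U => hasSum_log_partitionFunction U hq0 hq1)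
  -- Finite correction: `q ^ m / m * min m N` equals `q ^ m / m * N` except for `1 ≤ m ≤ N`.
  set f : ℕ → ℝ := fun m => if m ∈ Finset.Icc 1 N then q ^ m / m * N - q ^ m else 0 with hf
  have h2 : HasSum f (∑ m ∈ Finset.Icc 1 N, f m) :=
    hasSum_sum_of_ne_finset_zero fun m hm => if_neg hm
  have h3 : ∑ m ∈ Finset.Icc 1 N, f m =
      ∑ m ∈ Finset.Icc 1 N, q ^ m / m * N - ∑ m ∈ Finset.Icc 1 N, q ^ m := by
    rw [← Finset.sum_sub_distrib]
    exact Finset.sum_congr rfl fun m hm => if_pos hm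
  have h4 := ((hasSum_pow_div hq0 hq1).mul_right (N : ℝ)).sub h2
  have h5 : (fun m : ℕ => ∫ U, q ^ m / m * sqTrace m U ∂(haarUnitary N)) =
      fun m : ℕ => q ^ m / m * N - f m := by
    funext m
    rw [integral_const_mul]
    rcases Nat.eq_zero_or_pos m with rfl | hm
    · simp [hf]
    · rw [integral_sqTrace hm, hf]
      simp only [Finset.mem_Icc]
      have hm' : (m : ℝ) ≠ 0 := by positivity
      by_cases h : m ≤ N
      · rw [if_pos ⟨hm, h⟩, min_eq_left h]
        field_simp
        ring
      · rw [if_neg fun h' => h h'.2, min_eq_right (not_le.1 h).le, sub_zero]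
  rw [h5] at h1
  rw [h1.unique h4, h3, ← Finset.sum_mul]
  ring

end CUESchur

namespace CUESchur

/-! ### The limit of the mean -/

theorem sum_Icc_one_eq_sum_range (f : ℕ → ℝ) (N : ℕ) :
    ∑ m ∈ Finset.Icc 1 N, f m = ∑ k ∈ Finset.range N, f (k + 1) := by
  induction N with
  | zero => simp
  | succ N ih => rw [Finset.sum_Icc_succ_top (by omega), ih, Finset.sum_range_succ]

/-- Integral form of the remainder of the logarithm series at `1 - c / N`. The antiderivative
vanishes at `s = N`, and the geometric sum in its derivative reduces that derivative to the
integrand. -/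
theorem integral_one_sub_div_pow_div {c : ℝ} (hc : 0 < c) {N : ℕ} (hN : c < N) :
    ∫ s in c..N, (1 - s / N) ^ N / s =
      -Real.log (c / N) - ∑ m ∈ Finset.Icc 1 N, (1 - c / N) ^ m / m := by
  have hN0 : (0 : ℝ) < N := hc.trans hN
  have hpos : ∀ s ∈ Set.uIcc c (N : ℝ), 0 < s := fun s hs => by
    rw [Set.uIcc_of_le hN.le] at hs
    exact hc.trans_le hs.1
  have hderiv : ∀ s ∈ Set.uIcc c (N : ℝ), HasDerivAt (fun s : ℝ => Real.log (s / N) +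
      ∑ k ∈ Finset.range N, (1 - s / N) ^ (k + 1) / ((k : ℝ) + 1)) ((1 - s / N) ^ N / s) s := by
    intro s hs
    have hs0 := hpos s hs
    have h1 : HasDerivAt (fun s : ℝ => s / N) (1 / N) s := (hasDerivAt_id s).div_const _
    have h2 : HasDerivAt (fun s : ℝ => 1 - s / N) (-(1 / N)) s := by
      simpa using h1.const_sub 1
    have h3 := h1.log (by positivity)
    have h4 : HasDerivAt (fun s : ℝ => ∑ k ∈ Finset.range N, (1 - s / N) ^ (k + 1) / ((k : ℝ) + 1))
        (∑ k ∈ Finset.range N, (1 - s / N) ^ k * (-(1 / N))) s := by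
      refine HasDerivAt.fun_sum fun k _ => ?_
      have h5 := (h2.pow (k + 1)).div_const ((k : ℝ) + 1)
      convert! h5 using 1
      have : (k : ℝ) + 1 ≠ 0 := by positivity
      push_cast
      field_simp
    have h6 : (∑ k ∈ Finset.range N, (1 - s / N) ^ k) * (-(s / N)) = (1 - s / N) ^ N - 1 := by
      rw [← geom_sum_mul]
      ring
    convert! h3.add h4 using 1
    rw [← Finset.sum_mul]
    have h7 : (1 - s / N) ^ N = 1 + (∑ k ∈ Finset.range N, (1 - s / N) ^ k) * (-(s / N)) := by
      rw [h6]
      ring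
    rw [h7]
    field_simp
  rw [intervalIntegral.integral_eq_sub_of_hasDerivAt hderiv]
  · have h8 : ∑ k ∈ Finset.range N, (1 - (N : ℝ) / N) ^ (k + 1) / ((k : ℝ) + 1) = 0 :=
      Finset.sum_eq_zero fun k _ => by rw [div_self hN0.ne']; simp
    rw [sum_Icc_one_eq_sum_range, h8, div_self hN0.ne', Real.log_one]
    push_cast
    ring
  · refine ContinuousOn.intervalIntegrable fun s hs => ?_
    have hs0 := (hpos s hs).ne'
    exact ContinuousAt.continuousWithinAt (by fun_prop (disch := assumption))

theorem tendsto_integral_one_sub_div_pow_div {c : ℝ} (hc : 0 < c) :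
    Tendsto (fun N : ℕ => ∫ s in c..N, (1 - s / N) ^ N / s) atTop
      (𝓝 (∫ x in Set.Ioi (1 : ℝ), Real.exp (-(c * x)) / x)) := by
  have hlim : ∫ x in Set.Ioi (1 : ℝ), Real.exp (-(c * x)) / x =
      ∫ s in Set.Ioi c, Real.exp (-s) / s := by
    have h := integral_comp_mul_left_Ioi (fun s => Real.exp (-s) / s) 1 hc
    rw [mul_one, smul_eq_mul] at h
    rw [← mul_inv_cancel_left₀ hc.ne' (∫ s in Set.Ioi c, Real.exp (-s) / s), ← h,
      ← integral_const_mul]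
    refine setIntegral_congr_fun measurableSet_Ioi fun x _ => ?_
    field_simp
  have hmeas : ∀ N : ℕ, Measurable fun s : ℝ => (1 - s / N) ^ N / s := fun N => by fun_prop
  -- The integrands, extended by zero beyond `N`, converge to `exp (-s) / s` and are dominated by
  -- `exp (-s) / c` on `s > c`.
  have hDCT : Tendsto (fun N : ℕ => ∫ s in Set.Ioi c,
      (Set.Iic (N : ℝ)).indicator (fun s => (1 - s / N) ^ N / s) s) atTop
      (𝓝 (∫ s in Set.Ioi c, Real.exp (-s) / s)) := by
    refine tendsto_integral_of_dominated_convergence (fun s => Real.exp (-s) / c)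
      (fun N => ((hmeas N).indicator measurableSet_Iic).aestronglyMeasurable)
      ((integrableOn_exp_neg_Ioi c).div_const c) (fun N => ?_) ?_
    · filter_upwards [ae_restrict_mem measurableSet_Ioi] with s (hs : c < s)
      have hs0 := hc.trans hs
      by_cases h : s ≤ N
      · have hx : 0 ≤ 1 - s / N := by
          rw [sub_nonneg]
          exact div_le_one_of_le₀ h (hs0.le.trans h)
        rw [Set.indicator_of_mem (by exact h), Real.norm_of_nonneg (by positivity)]
        exact div_le_div₀ (Real.exp_pos _).le (Real.one_sub_div_pow_le_exp_neg h) hc hs.le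
      · rw [Set.indicator_of_notMem (by exact h), norm_zero]
        positivity
    · refine Eventually.of_forall fun s => ?_
      have h1 : Tendsto (fun N : ℕ => (1 - s / N) ^ N / s) atTop (𝓝 (Real.exp (-s) / s)) := by
        refine (Tendsto.congr (fun N => ?_) (Real.tendsto_one_add_div_pow_exp (-s))).div_const s
        rw [neg_div, ← sub_eq_add_neg]
      refine h1.congr' ?_
      filter_upwards [tendsto_natCast_atTop_atTop.eventually_ge_atTop s] with N hN
      rw [Set.indicator_of_mem (by exact hN)]
  rw [hlim]
  refine hDCT.congr' ?_
  filter_upwards [tendsto_natCast_atTop_atTop.eventually_ge_atTop c] with N hN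
  rw [setIntegral_indicator measurableSet_Iic, Set.Ioi_inter_Iic,
    intervalIntegral.integral_of_le hN]

theorem tendsto_sum_pow_div {c : ℝ} (hc : 0 < c) :
    Tendsto (fun N : ℕ => (∑ m ∈ Finset.Icc 1 N, (1 - c / N) ^ m) / N) atTop
      (𝓝 ((1 - Real.exp (-c)) / c)) := by
  have h1 : Tendsto (fun N : ℕ => (1 - c / N) ^ N) atTop (𝓝 (Real.exp (-c))) := by
    refine (Real.tendsto_one_add_div_pow_exp (-c)).congr fun N => ?_
    rw [neg_div, ← sub_eq_add_neg]
  have h2 : Tendsto (fun N : ℕ => 1 - c / N) atTop (𝓝 1) := by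
    simpa using (tendsto_const_div_atTop_nhds_zero_nat c).const_sub 1
  have h3 := (h2.mul (h1.const_sub 1)).div_const c
  rw [one_mul] at h3
  refine h3.congr' ?_
  filter_upwards [eventually_gt_atTop 0] with N hN
  have hN' : (N : ℝ) ≠ 0 := by positivity
  have h4 : (∑ k ∈ Finset.range N, (1 - c / N) ^ k) * (-(c / N)) = (1 - c / N) ^ N - 1 := by
    rw [← geom_sum_mul]
    ring
  have h5 : 1 - (1 - c / N) ^ N = (∑ k ∈ Finset.range N, (1 - c / N) ^ k) * (c / N) := by
    linarith
  rw [sum_Icc_one_eq_sum_range, h5]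
  simp only [pow_succ]
  rw [← Finset.sum_mul]
  field_simp

theorem fugacity_mem {c : ℝ} (hc : 0 < c) {N : ℕ} (hN : c < N) :
    0 ≤ 1 - c / N ∧ 1 - c / N < 1 := by
  have hN0 : (0 : ℝ) < N := hc.trans hN
  have h1 : c / N < 1 := (div_lt_one hN0).2 hN
  have h2 : 0 < c / N := by positivity
  constructor <;> linarith

theorem tendsto_integral_freeEnergy_div {c : ℝ} (hc : 0 < c) :
    Tendsto (fun N : ℕ => (∫ U, freeEnergy c U.1 ∂(haarUnitary N)) / N) atTop (𝓝 (mu c)) := by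
  have h := (tendsto_sum_pow_div hc).add (tendsto_integral_one_sub_div_pow_div hc)
  refine h.congr' ?_
  filter_upwards [tendsto_natCast_atTop_atTop.eventually_gt_atTop c] with N hN
  obtain ⟨hq0, hq1⟩ := fugacity_mem hc hN
  have hN0 : (N : ℝ) ≠ 0 := (hc.trans hN).ne'
  simp only [freeEnergy]
  rw [integral_log_partitionFunction hq0 hq1, integral_one_sub_div_pow_div hc hN, sub_sub_cancel]
  field_simp
  ring

end CUESchur

/-! ### Convergence in probability by Chebyshev's inequality -/

theorem mainTheorem4 {Ω : Type*} [MeasurableSpace Ω] (P : Measure Ω) [IsProbabilityMeasure P]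
    (U : (N : ℕ) → Ω → Matrix.unitaryGroup (Fin N) ℂ)
    (hU : ∀ N : ℕ, HasLaw (U N) (CUESchur.haarUnitary N) P)
    (c : ℝ) (hc : 0 < c) :
    TendstoInMeasure P
        (fun (N : ℕ) (ω : Ω) => (1 / (N : ℝ)) * CUESchur.freeEnergy c (U N ω).1)
        atTop (fun _ => CUESchur.mu c) ∧
      (∀ᶠ N : ℕ in atTop, MemLp (fun ω : Ω => CUESchur.freeEnergy c (U N ω).1) 2 P) ∧
      (fun N : ℕ => variance (fun ω : Ω => CUESchur.freeEnergy c (U N ω).1) P)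
        =O[atTop] (fun N : ℕ => (N : ℝ)) := by
  have hlarge : ∀ᶠ N : ℕ in atTop, c < N :=
    tendsto_natCast_atTop_atTop.eventually_gt_atTop c
  have hcont : ∀ N : ℕ, c < N → Continuous fun V : Matrix.unitaryGroup (Fin N) ℂ =>
      CUESchur.freeEnergy c V.1 := fun N hN =>
    CUESchur.continuous_log_partitionFunction (CUESchur.fugacity_mem hc hN).1
      (CUESchur.fugacity_mem hc hN).2
  have hmem : ∀ N : ℕ, c < N →
      MemLp (fun ω : Ω => CUESchur.freeEnergy c (U N ω).1) 2 P := by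
    intro N hN
    have h := CUESchur.memLp_of_continuous (hcont N hN)
    rw [← (hU N).map_eq] at h
    exact (memLp_map_measure_iff h.aestronglyMeasurable (hU N).aemeasurable).1 h
  have hmean : ∀ N : ℕ, c < N → ∫ ω, CUESchur.freeEnergy c (U N ω).1 ∂P =
      ∫ V, CUESchur.freeEnergy c V.1 ∂(CUESchur.haarUnitary N) := fun N hN =>
    (hU N).integral_comp (CUESchur.memLp_of_continuous (hcont N hN)).aestronglyMeasurable
  have hvar : ∀ N : ℕ, c < N →
      variance (fun ω : Ω => CUESchur.freeEnergy c (U N ω).1) P ≤ 5 / c * N := by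
    intro N hN
    have hN0 : (N : ℝ) ≠ 0 := (hc.trans hN).ne'
    have h1 := CUESchur.variance_log_partitionFunction_le (N := N)
      (CUESchur.fugacity_mem hc hN).1 (CUESchur.fugacity_mem hc hN).2
    have h2 := variance_map (X := fun V : Matrix.unitaryGroup (Fin N) ℂ =>
      CUESchur.freeEnergy c V.1) (hcont N hN).measurable.aemeasurable (hU N).aemeasurable
    rw [(hU N).map_eq] at h2
    have h3 : 5 / (1 - (1 - c / (N : ℝ))) = 5 / c * N := by
      rw [sub_sub_cancel]
      field_simp
    rw [← h3]
    exact h2.symm.trans_le h1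
  refine ⟨?_, hlarge.mono hmem, ?_⟩
  · rw [tendstoInMeasure_iff_norm]
    intro ε hε
    have hbound : Tendsto (fun N : ℕ => ENNReal.ofReal (20 / (c * ε ^ 2) / N)) atTop (𝓝 0) := by
      rw [← ENNReal.ofReal_zero]
      exact ENNReal.tendsto_ofReal (tendsto_const_div_atTop_nhds_zero_nat _)
    have hclose : ∀ᶠ N : ℕ in atTop,
        |(∫ V, CUESchur.freeEnergy c V.1 ∂(CUESchur.haarUnitary N)) / N - CUESchur.mu c| <
          ε / 2 := by
      simpa only [Real.dist_eq] using
        Metric.tendsto_nhds.1 (CUESchur.tendsto_integral_freeEnergy_div hc) (ε / 2) (by positivity)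
    refine tendsto_of_tendsto_of_tendsto_of_le_of_le' tendsto_const_nhds hbound
      (Eventually.of_forall fun _ => zero_le) ?_
    filter_upwards [hlarge, hclose] with N hN hN2
    have hN0 : (0 : ℝ) < N := hc.trans hN
    -- Half of `ε` is spent on the distance from the normalized mean to the limit. The other half,
    -- rescaled by `N`, is the Chebyshev threshold, and the variance bound `5 N / c` then gives `20
    -- / (c ε² N)`.
    have hcheb := meas_ge_le_variance_div_sq (hmem N hN) (c := N * ε / 2) (by positivity)
    refine (measure_mono fun ω hω => ?_).trans (hcheb.trans (ENNReal.ofReal_le_ofReal ?_))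
    · rw [Set.mem_ofPred_eq, Real.norm_eq_abs] at hω
      rw [Set.mem_ofPred_eq, hmean N hN]
      set E := ∫ V, CUESchur.freeEnergy c V.1 ∂(CUESchur.haarUnitary N)
      set X := CUESchur.freeEnergy c (U N ω).1
      have h1 : |1 / (N : ℝ) * X - CUESchur.mu c| ≤
          |1 / (N : ℝ) * X - E / N| + |E / N - CUESchur.mu c| := abs_sub_le _ _ _
      have h2 : |1 / (N : ℝ) * X - E / N| = |X - E| / N := by
        rw [← abs_of_pos hN0, ← abs_div, abs_of_pos hN0]
        congr 1
        ring
      have h3 : ε / 2 ≤ |X - E| / N := by linarith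
      rw [le_div_iff₀ hN0] at h3
      linarith
    · calc variance (fun ω : Ω => CUESchur.freeEnergy c (U N ω).1) P / (N * ε / 2) ^ 2
          ≤ 5 / c * N / (N * ε / 2) ^ 2 := by
            exact div_le_div_of_nonneg_right (hvar N hN) (by positivity)
        _ = 20 / (c * ε ^ 2) / N := by
            field_simp
            ring
  · refine Asymptotics.IsBigO.of_bound (5 / c) ?_
    filter_upwards [hlarge] with N hN
    rw [Real.norm_of_nonneg (variance_nonneg _ _), Real.norm_of_nonneg (Nat.cast_nonneg N)]
    exact hvar N hN
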